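/- Let $\Sigma=\Sigma_{\mathrm{call}}\uplus\Sigma_{\mathrm{int}}\uplus\Sigma_{\mathrm{ret}}$ be a visibly pushdown alphabet (a finite alphabet partitioned into three classes), and let $\Sigma^\triangle$ be the set of well-matched words: the smallest set that contains $\varepsilon$ and every $c\in\Sigma_{\mathrm{int}}$, is closed under concatenation, and contains $awb$ whenever it contains $w$, for $a\in\Sigma_{\mathrm{call}}$, $b\in\Sigma_{\mathrm{ret}}$. Let $L\subseteq\Sigma^\triangle$ be a visibly pushdown language, i.e. the set of words $w$ such that some fixed deterministic visibly pushdown automaton (pushing one non-bottom symbol on call letters, popping one symbol on return letters, leaving the stack unchanged on internal letters), started in its initial state with stack $\bot$, ends after reading $w$ in a final state with stack $\bot$. An Ext-algebra $(R,O)$ consists of a monoid $R$ and a submonoid $O$ of the monoid $(R^R,\circ)$ of all maps $R\to R$ that contains all left and right multiplications $x\mapsto rx$, $x\mapsto xr$ ($r\in R$). It is solvable if every subset of $R$ or of $O$ that is a group under the multiplication of $R$, resp. of $O$ (possibly with a neutral element different from that of the monoid), is a solvable group. For words $u,v$ with $uv\in\Sigma^\triangle$ let $\mathrm{ext}_{u,v}:\Sigma^\triangle\to\Sigma^\triangle$,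 $x\mapsto uxv$, and let $\mathcal O(\Sigma^\triangle)$ be the set of all these maps. The syntactic congruence of $L$ is given by $x\sim_L y$ iff ($e(x)\in L\Leftrightarrow e(y)\in L$ for all $e\in\mathcal O(\Sigma^\triangle)$). The syntactic Ext-algebra $(R_L,O_L)$ of $L$ has $R_L=\Sigma^\triangle/{\sim_L}$, and $O_L$ is the set of maps on $R_L$ induced by the elements of $\mathcal O(\Sigma^\triangle)$. Languages over finite alphabets are identified with binary languages through an arbitrary fixed encoding of the letters by distinct blocks of bits of the same positive length. Circuit families $(C_n)_{n\in\mathbb N}$ are non-uniform, $C_n$ having $n$ input bits. $\mathsf{AC}^0$ is the class of languages decided by circuit families with NOT gates and AND, OR gates of unbounded fan-in, of constant depth and polynomial size; $\mathsf{NC}^1$ is the class of languages decided by circuit families with NOT, AND, OR gates of bounded fan-in, of logarithmic depth and polynomial size. We write $K\le_{\mathrm{cd}}L$ (constant-depth truth-table reducibility) if there are a polynomial $p$, a constant $d$ and a circuit family $(C_n)_{n\in\mathbb N}$ deciding $K$ such that every $C_n$ has depth at most $d$ and size at most $p(n)$, each of its input gates is labelled by an input bit or a negated input bit, each other gate is an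 AND gate, an OR gate (both of unbounded fan-in) or an oracle gate deciding $L\cap\{0,1\}^m$ for some $m\le p(n)$, and there is no path from the output of an oracle gate to an input of an oracle gate. $L$ is $\mathsf{NC}^1$-hard if $K\le_{\mathrm{cd}}L$ for all $K\in\mathsf{NC}^1$. Proposition. If the syntactic Ext-algebra $(R_L,O_L)$ of the visibly pushdown language $L$ is not solvable, then $L$ is $\mathsf{NC}^1$-hard and $L\notin\mathsf{AC}^0$. -/

import Mathlib

/-! ## Boolean circuits with oracle gates -/

namespace BoolCircuit

/-- The label of a node of a circuit with `n` inputs and node set `V`, together with the nodes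
that are wired into it (in order, which matters for oracle gates only). `and []` and `or []` are
the constants true and false. -/
inductive Gate (n : ℕ) (V : Type) : Type
  | input (j : Fin n)
  | not (a : V)
  | and (l : List V)
  | or (l : List V)
  | oracle (l : List V)

namespace Gate

variable {n : ℕ} {V : Type}

/-- The nodes wired into a gate. -/
def args : Gate n V → List V
  | input _ => []
  | not a => [a]
  | and l => l
  | or l => l
  | oracle l => l

/-- An oracle gate of fan-in `m` decides `O ∩ {0,1}^m`. -/
def IsOracle : Gate n V → Prop
  | oracle _ => True
  | _ => False

open Classical in
/-- The output of a gate on the circuit input `x`, when oracle gates are answered by the binary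
language `O` and `val` gives the values of the nodes wired into the gate. -/
noncomputable def value (O : Set (List Bool)) (x : Fin n → Bool) (val : V → Bool) :
    Gate n V → Bool
  | input j => x j
  | not a => !(val a)
  | and l => l.all val
  | or l => l.any val
  | oracle l => decide (l.map val ∈ O)

theorem value_congr (O : Set (List Bool)) (x : Fin n → Bool) {val val' : V → Bool}
    (g : Gate n V) (h : ∀ a ∈ g.args, val a = val' a) : g.value O x val = g.value O x val' := by
  cases g with
  | input j => rfl
  | not a => simp [value, h a (by simp [args])]
  | and l =>
    have h' : ∀ a ∈ l, val a = val' a := h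
    rw [Bool.eq_iff_iff]
    simp only [value, List.all_eq_true]
    exact forall₂_congr fun a ha => by rw [h' a ha]
  | or l =>
    have h' : ∀ a ∈ l, val a = val' a := h
    rw [Bool.eq_iff_iff]
    simp only [value, List.any_eq_true]
    exact exists_congr fun a => and_congr_right fun ha => by rw [h' a ha]
  | oracle l =>
    have h' : l.map val = l.map val' := List.map_congr_left h
    simp [value, h']

end Gate

end BoolCircuit

/-- A circuit with `n` Boolean inputs: a finite acyclic graph of gates with a designated output. -/
structure BoolCircuit (n : ℕ) where
  V : Type
  [fintypeV : Fintype V]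
  gate : V → BoolCircuit.Gate n V
  output : V
  /-- Acyclicity: on a finite node set, the wire relation is well-founded iff it has no cycle. -/
  wf : WellFounded fun a v : V => a ∈ (gate v).args

namespace BoolCircuit

attribute [instance] BoolCircuit.fintypeV

variable {n : ℕ} (C : BoolCircuit n)

/-- There is a wire from `a` to `v`. -/
def Wire (a v : C.V) : Prop := a ∈ (C.gate v).args

/-- The number of nodes. -/
def size : ℕ := Fintype.card C.V

open Classical in
/-- The value of a node on input `x` with oracle `O`. -/
noncomputable def eval (O : Set (List Bool)) (x : Fin n → Bool) : C.V → Bool :=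
  C.wf.fix fun v ih =>
    (C.gate v).value O x fun a => if h : a ∈ (C.gate v).args then ih a h else false

theorem eval_eq (O : Set (List Bool)) (x : Fin n → Bool) (v : C.V) :
    C.eval O x v = (C.gate v).value O x (C.eval O x) := by
  rw [eval, WellFounded.fix_eq]
  apply Gate.value_congr
  intro a ha
  simp only [ha, dif_pos]

/-- The length of a longest directed path that ends in the node. -/
noncomputable def nodeDepth : C.V → ℕ :=
  C.wf.fix fun v ih => ((C.gate v).args.attach.map fun a => ih a.1 a.2 + 1).foldr max 0

theorem nodeDepth_eq (v : C.V) :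
    C.nodeDepth v = ((C.gate v).args.map fun a => C.nodeDepth a + 1).foldr max 0 := by
  conv_lhs => rw [nodeDepth, WellFounded.fix_eq]
  conv_rhs => rw [← List.attach_map_subtype_val (C.gate v).args, List.map_map]
  rfl

/-- The length of a longest directed path in the circuit. -/
noncomputable def depth : ℕ := Finset.univ.sup C.nodeDepth

/-- The circuit has no oracle gates. -/
def OracleFree : Prop := ∀ v, ¬ (C.gate v).IsOracle

/-- Every gate has fan-in at most `b`. -/
def FanInLE (b : ℕ) : Prop := ∀ v, (C.gate v).args.length ≤ b

/-- Negation is applied to inputs only: up to negated inputs (literals), all non-input nodes are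
AND, OR or oracle gates. -/
def NegationsOnInputs : Prop :=
  ∀ v a, C.gate v = Gate.not a → ∃ j, C.gate a = Gate.input j

/-- Every oracle gate has fan-in at most `b`. -/
def OracleFanInLE (b : ℕ) : Prop :=
  ∀ v, (C.gate v).IsOracle → (C.gate v).args.length ≤ b

/-- There is no directed path from an oracle gate to an oracle gate. -/
def OraclesNotNested : Prop :=
  ∀ v w, (C.gate v).IsOracle → (C.gate w).IsOracle → ¬ Relation.TransGen C.Wire v w

/-- The family `C` decides the binary language `K`, with oracle gates answered by `O`. -/
def Decides (C : ∀ n, BoolCircuit n) (O K : Set (List Bool)) : Prop :=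
  ∀ n (x : Fin n → Bool), (C n).eval O x (C n).output = true ↔ List.ofFn x ∈ K

end BoolCircuit

/-! ## Complexity classes and reductions

All classes are non-uniform. A language over another finite alphabet is identified with the binary
language obtained from a fixed-length encoding of its letters, see `BlockEncoding`. -/

/-- `AC⁰`: NOT, AND and OR gates of unbounded fan-in, constant depth, polynomial size. -/
def InAC0 (K : Set (List Bool)) : Prop :=
  ∃ (C : ∀ n, BoolCircuit n) (p : Polynomial ℕ) (d : ℕ),
    (∀ n, (C n).OracleFree ∧ (C n).size ≤ p.eval n ∧ (C n).depth ≤ d) ∧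
    BoolCircuit.Decides C ∅ K

/-- `NC¹`: NOT, AND and OR gates of bounded fan-in, logarithmic depth, polynomial size. -/
def InNC1 (K : Set (List Bool)) : Prop :=
  ∃ (C : ∀ n, BoolCircuit n) (p : Polynomial ℕ) (c b : ℕ),
    (∀ n, (C n).OracleFree ∧ (C n).FanInLE b ∧ (C n).size ≤ p.eval n ∧
      (C n).depth ≤ c * (Nat.log 2 n + 1)) ∧
    BoolCircuit.Decides C ∅ K

/-- Constant-depth truth-table reducibility `K ≤_cd L`. -/
def CDReducible (K L : Set (List Bool)) : Prop :=
  ∃ (C : ∀ n, BoolCircuit n) (p : Polynomial ℕ) (d : ℕ),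
    (∀ n, (C n).NegationsOnInputs ∧ (C n).OraclesNotNested ∧ (C n).OracleFanInLE (p.eval n) ∧
      (C n).size ≤ p.eval n ∧ (C n).depth ≤ d) ∧
    BoolCircuit.Decides C L K

/-- `L` is `NC¹`-hard under constant-depth reductions. -/
def NC1Hard (L : Set (List Bool)) : Prop := ∀ K : Set (List Bool), InNC1 K → CDReducible K L

/-- An encoding of the letters of an alphabet by distinct blocks of bits of the same length. -/
structure BlockEncoding (α : Type*) where
  width : ℕ
  width_pos : 0 < width
  code : α → List Bool
  length_code : ∀ a, (code a).length = width
  injective : Function.Injective code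

/-- The binary language that encodes the language `L`. -/
def BlockEncoding.lang {α : Type*} (c : BlockEncoding α) (L : Set (List α)) : Set (List Bool) :=
  (fun w : List α => w.flatMap c.code) '' L

/-! ## Visibly pushdown languages -/

/-- The three kinds of letters. A visibly pushdown alphabet is a finite type `α` with a map
`kind : α → LetterKind`, i.e. a partition of `α` into three classes. -/
inductive LetterKind : Type
  | call
  | int
  | ret

/-- Well-matched words. -/
inductive WellMatched {α : Type*} (kind : α → LetterKind) : List α → Prop
  | nil : WellMatched kind []
  | int (c : α) : kind c = LetterKind.int → WellMatched kind [c]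
  | wrap (a b : α) (w : List α) : kind a = LetterKind.call → kind b = LetterKind.ret →
      WellMatched kind w → WellMatched kind (a :: (w ++ [b]))
  | append (u v : List α) : u ≠ [] → v ≠ [] → WellMatched kind u → WellMatched kind v →
      WellMatched kind (u ++ v)

namespace WellMatched

variable {α : Type*} {kind : α → LetterKind}

theorem append' {u v : List α} (hu : WellMatched kind u) (hv : WellMatched kind v) :
    WellMatched kind (u ++ v) := by
  by_cases h1 : u = []
  · simpa [h1] using hv
  by_cases h2 : v = []
  · simpa [h2] using hu
  exact append u v h1 h2 hu hv

theorem insert_aux {x w : List α} (hx : WellMatched kind x) (hw : WellMatched kind w) :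
    ∀ u v : List α, w = u ++ v → WellMatched kind (u ++ (x ++ v)) := by
  induction hw with
  | nil =>
    intro u v h
    obtain ⟨rfl, rfl⟩ := List.append_eq_nil_iff.1 h.symm
    simpa using hx
  | int c hc =>
    intro u v h
    cases u with
    | nil =>
      obtain rfl : [c] = v := h
      simpa using append' hx (int c hc)
    | cons a u =>
      simp only [List.cons_append, List.cons.injEq] at h
      obtain ⟨rfl, h⟩ := h
      obtain ⟨rfl, rfl⟩ := List.append_eq_nil_iff.1 h.symm
      simpa using append' (int c hc) hx
  | wrap a b w ha hb hw ih =>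
    intro u v h
    cases u with
    | nil =>
      obtain rfl : a :: (w ++ [b]) = v := h
      simpa using append' hx (wrap a b w ha hb hw)
    | cons a' u =>
      simp only [List.cons_append, List.cons.injEq] at h
      obtain ⟨rfl, h⟩ := h
      rcases List.eq_nil_or_concat v with rfl | ⟨v', b', rfl⟩
      · obtain rfl : w ++ [b] = u := by simpa using h
        simpa using append' (wrap a b w ha hb hw) hx
      · rw [List.concat_eq_append, ← List.append_assoc] at h
        obtain ⟨h1, h2⟩ := List.append_inj' h rfl
        obtain rfl : b = b' := by simpa using h2
        simpa using wrap a b _ ha hb (ih u v' h1)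
  | append w₁ w₂ _ _ h₁ h₂ ih₁ ih₂ =>
    intro u v h
    rcases List.append_eq_append_iff.1 h with ⟨t, rfl, rfl⟩ | ⟨t, rfl, rfl⟩
    · simpa using append' h₁ (ih₂ t v rfl)
    · simpa using append' (ih₁ u t rfl) h₂

end WellMatched

/-- The transition data of a deterministic visibly pushdown automaton with states `Q` and stack
alphabet `Γ`. The head of a stack list is the top of the stack. -/
structure DVPA {α : Type*} (kind : α → LetterKind) (Q Γ : Type) where
  δ : Q → α → Γ → Q × List Γ
  q₀ : Q
  F : Set Q
  bot : Γ
  δ_call : ∀ q a s, kind a = LetterKind.call → ∃ t, t ≠ bot ∧ (δ q a s).2 = [t, s]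
  δ_ret : ∀ q a s, kind a = LetterKind.ret → (δ q a s).2 = []
  δ_int : ∀ q a s, kind a = LetterKind.int → (δ q a s).2 = [s]

namespace DVPA

variable {α : Type*} {kind : α → LetterKind} {Q Γ : Type} (A : DVPA kind Q Γ)

/-- The extended transition function. -/
def run : Q → List α → List Γ → Q × List Γ
  | q, [], β => (q, β)
  | q, _ :: _, [] => (q, [])
  | q, a :: w, s :: β => run (A.δ q a s).1 w ((A.δ q a s).2 ++ β)

/-- The accepted language. -/
def language : Set (List α) :=
  {w | (A.run A.q₀ w [A.bot]).1 ∈ A.F ∧ (A.run A.q₀ w [A.bot]).2 = [A.bot]}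

end DVPA

/-- Visibly pushdown languages. -/
def IsVPL {α : Type*} (kind : α → LetterKind) (L : Set (List α)) : Prop :=
  ∃ (Q Γ : Type) (_ : Finite Q) (_ : Finite Γ) (A : DVPA kind Q Γ), A.language = L

/-! ## Ext-algebras -/

/-- An Ext-algebra `(R, O)` on the monoid `R`. The product of `Function.End R` is composition. -/
structure ExtAlgebra (R : Type*) [Monoid R] where
  O : Submonoid (Function.End R)
  left_mem : ∀ r : R, ((fun x => r * x) : Function.End R) ∈ O
  right_mem : ∀ r : R, ((fun x => x * r) : Function.End R) ∈ O

/-- Every subset of the semigroup `M` that is a group under the multiplication of `M` (possibly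
with a neutral element different from that of `M`) is a solvable group. -/
def GroupsInSolvable (M : Type*) [Mul M] : Prop :=
  ∀ (S : Set M) [Group S], (∀ x y : S, ((x * y : S) : M) = (x : M) * (y : M)) → Group.IsSolvable S

namespace ExtAlgebra

variable {R : Type*} [Monoid R]

/-- A solvable Ext-algebra. -/
def Solvable (A : ExtAlgebra R) : Prop := GroupsInSolvable R ∧ GroupsInSolvable A.O

/-- A congruence on an Ext-algebra. -/
def IsCongruence (A : ExtAlgebra R) (s : Setoid R) : Prop :=
  ∀ e ∈ A.O, ∀ x y, s x y → s (e x) (e y)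

/-- A congruence on an Ext-algebra `(R, O)` is in particular a congruence on the monoid `R`. -/
def con (A : ExtAlgebra R) (s : Setoid R) (hs : A.IsCongruence s) : Con R where
  toSetoid := s
  mul' {w x y z} h₁ h₂ :=
    s.trans (hs _ (A.right_mem y) w x h₁) (hs _ (A.left_mem x) y z h₂)

/-- The quotient of an Ext-algebra by a congruence. -/
def quotient (A : ExtAlgebra R) (s : Setoid R) (hs : A.IsCongruence s) :
    ExtAlgebra (A.con s hs).Quotient where
  O :=
    { carrier := {e' | ∃ e ∈ A.O, ∀ x : R,
        e' (x : (A.con s hs).Quotient) = ((e x : R) : (A.con s hs).Quotient)}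
      one_mem' := ⟨1, A.O.one_mem, fun _ => rfl⟩
      mul_mem' := by
        rintro f' g' ⟨f, hf, hf'⟩ ⟨g, hg, hg'⟩
        refine ⟨f * g, A.O.mul_mem hf hg, fun x => ?_⟩
        change f' (g' _) = _
        rw [hg', hf']
        rfl }
  left_mem r' := by
    induction r' using Con.induction_on with
    | H r => exact ⟨_, A.left_mem r, fun _ => rfl⟩
  right_mem r' := by
    induction r' using Con.induction_on with
    | H r => exact ⟨_, A.right_mem r, fun _ => rfl⟩

/-- The syntactic equivalence of `F ⊆ R`: `x ∼ y` iff `e(x) ∈ F ↔ e(y) ∈ F` for all `e ∈ O`. -/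
def syntacticSetoid (A : ExtAlgebra R) (F : Set R) : Setoid R where
  r x y := ∀ e ∈ A.O, e x ∈ F ↔ e y ∈ F
  iseqv :=
    { refl := fun _ _ _ => Iff.rfl
      symm := fun h e he => (h e he).symm
      trans := fun h k e he => (h e he).trans (k e he) }

theorem isCongruence_syntacticSetoid (A : ExtAlgebra R) (F : Set R) :
    A.IsCongruence (A.syntacticSetoid F) :=
  fun e he _ _ h f hf => h (f * e) (A.O.mul_mem hf he)

end ExtAlgebra

/-- The monoid of well-matched words under concatenation. -/
def wellMatchedWords {α : Type*} (kind : α → LetterKind) : Submonoid (FreeMonoid α) where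
  carrier := {w | WellMatched kind w.toList}
  one_mem' := WellMatched.nil
  mul_mem' := WellMatched.append'

/-- The map `ext_{u,v} : x ↦ u x v` on well-matched words, for a context `(u, v)`, i.e. for words
`u`, `v` such that `u v` is well-matched. -/
def extMap {α : Type*} {kind : α → LetterKind} (u v : FreeMonoid α)
    (h : u * v ∈ wellMatchedWords kind) : Function.End (wellMatchedWords kind) :=
  fun x => ⟨u * (x * v), WellMatched.insert_aux x.2 h u v rfl⟩

/-- The Ext-algebra of well-matched words with all maps `ext_{u,v}`. -/
def wellMatchedExtAlgebra {α : Type*} (kind : α → LetterKind) :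
    ExtAlgebra (wellMatchedWords kind) where
  O :=
    { carrier := {f | ∃ (u v : FreeMonoid α) (h : u * v ∈ wellMatchedWords kind), f = extMap u v h}
      one_mem' := ⟨1, 1, by simp, by funext x; apply Subtype.ext; simp [extMap, Function.End.one_def]⟩
      mul_mem' := by
        rintro _ _ ⟨u, v, h, rfl⟩ ⟨u', v', h', rfl⟩
        refine ⟨u * u', v' * v, ?_, ?_⟩
        · have := (extMap u v h ⟨u' * v', h'⟩).2
          simpa [extMap, mul_assoc] using this
        · funext x
          apply Subtype.ext
          change u * (u' * (x * v') * v) = u * u' * (x * (v' * v))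
          simp only [mul_assoc] }
  left_mem r := ⟨r, 1, by simp, by funext x; apply Subtype.ext; simp [extMap]⟩
  right_mem r := ⟨1, r, by simp, by funext x; apply Subtype.ext; simp [extMap]⟩

/-- The syntactic Ext-algebra `(R_L, O_L)` of a language `L` of well-matched words. -/
def syntacticExtAlgebra {α : Type*} (kind : α → LetterKind) (L : Set (List α)) :=
  (wellMatchedExtAlgebra kind).quotient
    ((wellMatchedExtAlgebra kind).syntacticSetoid {w | (w : FreeMonoid α).toList ∈ L})
    ((wellMatchedExtAlgebra kind).isCongruence_syntacticSetoid _)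

/-! A non-solvable syntactic Ext-algebra provides a nonsolvable group acting faithfully on `R_L` by
maps that contexts induce: a group inside `R_L` acts by left multiplication, a group inside `O_L`
acts as it stands. `R_L` is finite, because a well-matched word affects a run only through the map
(state, stack top) ↦ state. So the group is finite and has a nontrivial subgroup `H` with `⁅H, H⁆ =
H`.

Barrington's argument then runs with contexts in place of words. Nesting contexts multiplies group
elements, commutators realise conjunction, and a circuit of bounded fan-in becomes a context of
length exponential in its depth whose letters depend on at most one input bit each. There is no
neutral letter for padding; instead `exists_basic_bound` uses that `g h g⁻¹ h⁻¹` and `g g⁻¹ h h⁻¹`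
are spelled by contexts of the same lengths. Some fixed `a`, `m`, `b` separate an element `g ≠ 1` of
`H` from `1` by membership of `a u m v b` in `L`. Hence circuits of bounded fan-in are projections
of `L` (`exists_projections`), of polynomial length when the depth is logarithmic, and a projection
is a reduction with one oracle gate.

Parity is likewise a projection of `L` of polynomial length, so `L ∈ AC⁰` would contradict the
Razborov–Smolensky bound. Over the field with three elements, a small shallow circuit agrees with a
low-degree function on most inputs (`exists_approximation`), while such a function agrees with
parity on little more than half of the cube (`card_le_of_agrees_parity`). The bound is proved for
circuits whose inputs are functions of degree one, so it applies directly to a circuit for `L` fed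
with a projection. -/

/-! ## Low-degree functions on the cube over the field with three elements -/

section Cube

variable {n : ℕ}

/-- A truth value as an element of the field with three elements. -/
def bit3 (b : Bool) : ZMod 3 := if b then 1 else 0

/-- The character `x ↦ (-1) ^ ∑ i ∈ S, x i` of the cube. -/
def signChar (S : Finset (Fin n)) : (Fin n → Bool) → ZMod 3 :=
  fun x => ∏ i, if i ∈ S ∧ x i = true then -1 else 1

theorem signChar_mul (S T : Finset (Fin n)) :
    signChar S * signChar T = signChar (symmDiff S T) := by
  funext x
  simp only [signChar, Pi.mul_apply, ← Finset.prod_mul_distrib]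
  refine Finset.prod_congr rfl fun i _ => ?_
  by_cases hS : i ∈ S <;> by_cases hT : i ∈ T <;> cases x i <;>
    simp [Finset.mem_symmDiff, hS, hT]

theorem signChar_empty : signChar (∅ : Finset (Fin n)) = 1 := by
  funext x
  simp [signChar]

theorem signChar_singleton (i : Fin n) (x : Fin n → Bool) :
    signChar {i} x = if x i then -1 else 1 := by
  rw [signChar, Finset.prod_eq_single i] <;> simp +contextual

/-- The functions on the cube that are polynomials of degree at most `d`. -/
def degLE (n d : ℕ) : Submodule (ZMod 3) ((Fin n → Bool) → ZMod 3) :=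
  Submodule.span (ZMod 3) (signChar '' {S | S.card ≤ d})

theorem signChar_mem_degLE {S : Finset (Fin n)} {d : ℕ} (h : S.card ≤ d) :
    signChar S ∈ degLE n d :=
  Submodule.subset_span ⟨S, h, rfl⟩

theorem degLE_mono {d e : ℕ} (h : d ≤ e) : degLE n d ≤ degLE n e :=
  Submodule.span_mono (Set.image_mono fun _ hS => le_trans hS h)

theorem mul_mem_degLE {d e : ℕ} {f g : (Fin n → Bool) → ZMod 3} (hf : f ∈ degLE n d)
    (hg : g ∈ degLE n e) : f * g ∈ degLE n (d + e) := by
  have h := Submodule.mul_mem_mul hf hg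
  rw [degLE, degLE, Submodule.span_mul_span] at h
  refine Submodule.span_mono ?_ h
  rintro _ ⟨_, ⟨S, hS, rfl⟩, _, ⟨T, hT, rfl⟩, rfl⟩
  refine ⟨symmDiff S T, ?_, (signChar_mul S T).symm⟩
  have h1 : (symmDiff S T).card ≤ (S ∪ T).card :=
    Finset.card_le_card fun i hi => by
      rw [Finset.mem_symmDiff] at hi
      rw [Finset.mem_union]
      tauto
  exact h1.trans ((Finset.card_union_le S T).trans (add_le_add hS hT))

theorem one_mem_degLE (d : ℕ) : (1 : (Fin n → Bool) → ZMod 3) ∈ degLE n d := by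
  rw [← signChar_empty]
  exact signChar_mem_degLE (by simp)

theorem const_mem_degLE (d : ℕ) (a : ZMod 3) : (fun _ : Fin n → Bool => a) ∈ degLE n d := by
  convert (degLE n d).smul_mem a (one_mem_degLE d) using 1
  funext x
  simp

theorem coordinate_mem_degLE (i : Fin n) (h : Bool → ZMod 3) :
    (fun x : Fin n → Bool => h (x i)) ∈ degLE n 1 := by
  have h1 := (degLE n 1).add_mem (const_mem_degLE 1 (h false - (h true - h false)))
    ((degLE n 1).smul_mem (h true - h false) (signChar_mem_degLE (S := {i}) (d := 1) (by simp)))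
  convert h1 using 1
  funext x
  simp only [Pi.add_apply, Pi.smul_apply, signChar_singleton, smul_eq_mul]
  have key : ∀ a b : ZMod 3, a = b - (a - b) + (a - b) * -1 := by decide
  cases x i
  · simp
  · simpa using key (h true) (h false)

theorem prod_mem_degLE {ι : Type*} (s : Finset ι) (f : ι → (Fin n → Bool) → ZMod 3)
    (hf : ∀ i ∈ s, f i ∈ degLE n 1) : ∏ i ∈ s, f i ∈ degLE n s.card := by
  classical
  induction s using Finset.induction_on with
  | empty => simpa using one_mem_degLE 0
  | insert a s ha ih =>
    rw [Finset.prod_insert ha, Finset.card_insert_of_notMem ha, add_comm]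
    exact mul_mem_degLE (hf a (by simp)) (ih fun i hi => hf i (by simp [hi]))

/-- The indicator of a point is a product of `n` functions of one coordinate each. -/
theorem degLE_self : degLE n n = ⊤ := by
  rw [eq_top_iff]
  rintro f -
  have h : f = ∑ y : Fin n → Bool,
      f y • ∏ i : Fin n, fun x : Fin n → Bool => if x i = y i then (1 : ZMod 3) else 0 := by
    funext x
    simp only [Finset.sum_apply, Pi.smul_apply, Finset.prod_apply, smul_eq_mul]
    rw [Finset.sum_eq_single x]
    · simp
    · intro y _ hy
      obtain ⟨i, hi⟩ : ∃ i, x i ≠ y i := by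
        by_contra! h
        exact hy (funext fun i => (h i).symm)
      rw [Finset.prod_eq_zero (Finset.mem_univ i) (by simp [hi]), mul_zero]
    · simp
  rw [h]
  refine Submodule.sum_mem _ fun y _ => Submodule.smul_mem _ _ ?_
  have := prod_mem_degLE (n := n) Finset.univ
    (fun i : Fin n => fun x : Fin n → Bool => if x i = y i then (1 : ZMod 3) else 0)
    fun i _ => coordinate_mem_degLE i fun b => if b = y i then 1 else 0
  simpa using this

/-- A low-degree function can agree with the parity character on a small set only. -/
theorem card_le_of_agrees_parity (A : Finset (Fin n → Bool)) {D m : ℕ} (hn : n = 2 * m)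
    {p : (Fin n → Bool) → ZMod 3} (hp : p ∈ degLE n D)
    (hA : ∀ x ∈ A, p x = signChar Finset.univ x) :
    A.card ≤ (Finset.univ.filter fun S : Finset (Fin n) => S.card ≤ m + D).card := by
  let res : ((Fin n → Bool) → ZMod 3) →ₗ[ZMod 3] (A → ZMod 3) :=
    LinearMap.funLeft _ _ Subtype.val
  have hsurj : (degLE n (m + D)).map res = ⊤ := by
    have h1 : (⊤ : Submodule (ZMod 3) ((Fin n → Bool) → ZMod 3)).map res = ⊤ := by
      rw [Submodule.map_top, LinearMap.range_eq_top]
      exact LinearMap.funLeft_surjective_of_injective _ _ _ Subtype.val_injective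
    rw [eq_top_iff, ← h1, ← degLE_self, degLE, Submodule.map_span, Submodule.span_le]
    rintro _ ⟨_, ⟨S, -, rfl⟩, rfl⟩
    by_cases hS : S.card ≤ m + D
    · exact Submodule.mem_map_of_mem (signChar_mem_degLE hS)
    -- On `A` the function `p` is the full parity character, so a character of degree above `m + D`
    -- can be traded for the complementary one, of degree at most `m`, times `p`.
    · have h2 : res (signChar S) = res (signChar Sᶜ * p) := by
        funext x
        change signChar S x.1 = signChar Sᶜ x.1 * p x.1
        rw [hA x.1 x.2, ← Pi.mul_apply, signChar_mul]
        congr 1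
        ext i
        simp [Finset.mem_symmDiff]
      rw [h2]
      have h3 : Sᶜ.card ≤ m := by
        rw [Finset.card_compl, Fintype.card_fin]
        omega
      exact Submodule.mem_map_of_mem (mul_mem_degLE (signChar_mem_degLE h3) hp)
  classical
  have h4 : A.card = Module.finrank (ZMod 3) (A → ZMod 3) := by simp
  rw [h4, ← finrank_top, ← hsurj]
  refine (Submodule.finrank_map_le res _).trans ?_
  have h5 : (signChar '' {S : Finset (Fin n) | S.card ≤ m + D})
      = ((Finset.univ.filter fun S : Finset (Fin n) => S.card ≤ m + D).image signChar :
        Finset ((Fin n → Bool) → ZMod 3)) := by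
    ext; simp
  rw [degLE, h5]
  exact (finrank_span_finset_le_card _).trans Finset.card_image_le

theorem signChar_univ (x : Fin n → Bool) :
    signChar Finset.univ x
      = if ((List.finRange n).map x).foldr xor false then (-1 : ZMod 3) else 1 := by
  have h : ∀ l : List (Fin n), (l.map fun i => if x i = true then (-1 : ZMod 3) else 1).prod
      = if (l.map x).foldr xor false then (-1 : ZMod 3) else 1 := by
    intro l
    induction l with
    | nil => simp
    | cons a l ih =>
      rw [List.map_cons, List.prod_cons, ih, List.map_cons, List.foldr_cons]
      cases x a <;> cases (l.map x).foldr xor false <;> simp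
  rw [← h, signChar]
  simp [← List.prod_ofFn, List.ofFn_eq_map]

end Cube

/-! ## Middle binomial coefficients -/

/-- The bound `4 ^ m / √(2m + 1)` without the root; the induction step amounts to `(2m + 1)(2m + 3)
≤ (2m + 2)²`. -/
theorem two_mul_add_one_mul_centralBinom_sq_le (m : ℕ) :
    (2 * m + 1) * m.centralBinom ^ 2 ≤ 16 ^ m := by
  induction m with
  | zero => simp
  | succ m ih =>
    have h := Nat.succ_mul_centralBinom_succ m
    have h1 : (m + 1) ^ 2 * ((2 * (m + 1) + 1) * (m + 1).centralBinom ^ 2)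
        = (2 * m + 3) * (2 * m + 1) * 4 * ((2 * m + 1) * m.centralBinom ^ 2) := by
      have : (m + 1) ^ 2 * ((2 * (m + 1) + 1) * (m + 1).centralBinom ^ 2)
        = (2 * m + 3) * ((m + 1) * (m + 1).centralBinom) ^ 2 := by ring
      rw [this, h]
      ring
    refine le_of_mul_le_mul_left (a := (m + 1) ^ 2) ?_ (pow_pos m.succ_pos 2)
    rw [h1]
    calc (2 * m + 3) * (2 * m + 1) * 4 * ((2 * m + 1) * m.centralBinom ^ 2)
        ≤ (2 * m + 3) * (2 * m + 1) * 4 * 16 ^ m := Nat.mul_le_mul_left _ ih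
      _ ≤ ((m + 1) ^ 2 * 16) * 16 ^ m := Nat.mul_le_mul_right _ (by nlinarith)
      _ = (m + 1) ^ 2 * 16 ^ (m + 1) := by ring

theorem two_mul_sum_range_choose_le (m : ℕ) :
    2 * ∑ i ∈ Finset.range m, (2 * m).choose i ≤ 4 ^ m := by
  have h1 : ∑ i ∈ Finset.range m, (2 * m).choose i
      ≤ ∑ i ∈ Finset.Ico (m + 1) (2 * m + 1), (2 * m).choose i := by
    rw [Finset.sum_Ico_eq_sum_range, show 2 * m + 1 - (m + 1) = m by omega,
      ← Finset.sum_range_reflect]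
    refine Finset.sum_le_sum fun i hi => ?_
    rw [Finset.mem_range] at hi
    rw [← Nat.choose_symm (show m - 1 - i ≤ 2 * m by omega)]
    rw [show 2 * m - (m - 1 - i) = m + 1 + i by omega]
  have h2 := Nat.sum_range_choose (2 * m)
  rw [Finset.range_eq_Ico, ← Finset.sum_Ico_consecutive _ (Nat.zero_le m) (by omega : m ≤ 2 * m + 1),
    ← Finset.sum_Ico_consecutive _ (by omega : m ≤ m + 1) (by omega : m + 1 ≤ 2 * m + 1),
    ← Finset.range_eq_Ico, pow_mul] at h2
  norm_num at h2
  omega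

/-- The layers below `m` hold at most half of all sets, and each of the `D + 1` layers from `m` to
`m + D` is at most as large as the middle one. -/
theorem two_mul_card_filter_card_le (m D : ℕ) :
    2 * (Finset.univ.filter fun S : Finset (Fin (2 * m)) => S.card ≤ m + D).card
      ≤ 4 ^ m + 2 * (D + 1) * m.centralBinom := by
  have h1 : (Finset.univ.filter fun S : Finset (Fin (2 * m)) => S.card ≤ m + D).card
      ≤ ∑ i ∈ Finset.range (m + D + 1), (2 * m).choose i := by
    rw [Finset.card_eq_sum_card_fiberwise (f := Finset.card)
      (t := Finset.range (m + D + 1)) (fun S hS => by simp at hS ⊢; omega)]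
    refine Finset.sum_le_sum fun i _ => ?_
    rw [← Finset.card_fin (2 * m), ← Finset.card_powersetCard, Finset.card_fin]
    refine Finset.card_le_card fun S hS => ?_
    simp at hS
    simp [Finset.mem_powersetCard, hS.2]
  have h2 : ∑ i ∈ Finset.range (m + D + 1), (2 * m).choose i
      ≤ ∑ i ∈ Finset.range m, (2 * m).choose i + (D + 1) * m.centralBinom := by
    rw [show m + D + 1 = m + (D + 1) by ring, Finset.sum_range_add]
    refine Nat.add_le_add_left ?_ _
    refine (Finset.sum_le_card_nsmul _ _ m.centralBinom fun i _ =>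
      Nat.choose_le_centralBinom _ _).trans (by simp)
  have h3 := two_mul_sum_range_choose_le m
  nlinarith

/-! ## Approximating circuits by low-degree functions -/

section Approximation

/-- Some linear form vanishes on at most half of the given nonzero vectors. -/
theorem exists_linear_form_halving {X V : Type*} [Fintype V] (B : Finset X) (args : Finset V)
    (y : X → V → Bool) (hB : ∀ x ∈ B, ∃ a ∈ args, y x a = true) :
    ∃ c : V → ZMod 3,
      2 * (B.filter fun x => ∑ a ∈ args, c a * bit3 (y x a) = 0).card ≤ B.card := by
  classical
  -- Averaging: for each vector of `B` at most half of all forms vanish, so some form vanishes on at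
  -- most half of `B`.
  by_contra! hcon
  have hx : ∀ x ∈ B, 2 * (Finset.univ.filter fun c : V → ZMod 3 =>
      ∑ a ∈ args, c a * bit3 (y x a) = 0).card ≤ Fintype.card (V → ZMod 3) := by
    intro x hx
    obtain ⟨a, ha, hya⟩ := hB x hx
    set Z := Finset.univ.filter fun c : V → ZMod 3 => ∑ a ∈ args, c a * bit3 (y x a) = 0 with hZ
    -- Adding the unit vector at a true argument raises the value of the form by 1, which injects
    -- vanishing forms into nonvanishing ones.
    have hinj : Z.card ≤ Zᶜ.card := by
      refine Finset.card_le_card_of_injOn (fun c => c + Pi.single a 1) ?_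
        fun c _ c' _ h => add_right_cancel h
      intro c hc
      have hc : ∑ a ∈ args, c a * bit3 (y x a) = 0 := by simpa [hZ] using hc
      have h1 : ∑ b ∈ args, (Pi.single a 1 : V → ZMod 3) b * bit3 (y x b) = 1 := by
        rw [Finset.sum_eq_single a]
        · simp [bit3, hya]
        · intro b _ hb
          simp [hb]
        · exact fun h => absurd ha h
      simp [hZ, add_mul, Finset.sum_add_distrib, hc, h1]
    rw [Finset.card_compl] at hinj
    have := Finset.card_le_univ Z
    omega
  have hswap : ∑ c : V → ZMod 3, (B.filter fun x => ∑ a ∈ args, c a * bit3 (y x a) = 0).card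
      = ∑ x ∈ B, (Finset.univ.filter fun c : V → ZMod 3 =>
          ∑ a ∈ args, c a * bit3 (y x a) = 0).card := by
    simp only [Finset.card_filter]
    exact Finset.sum_comm
  have h1 := Finset.sum_le_sum hx
  have h2 : ∑ _c : V → ZMod 3, B.card
      < ∑ c : V → ZMod 3, 2 * (B.filter fun x => ∑ a ∈ args, c a * bit3 (y x a) = 0).card :=
    Finset.sum_lt_sum_of_nonempty ⟨0, Finset.mem_univ _⟩ fun c _ => hcon c
  rw [← Finset.mul_sum, hswap] at h2
  rw [← Finset.mul_sum] at h1
  simp only [Finset.sum_const, smul_eq_mul, Finset.card_univ] at h1 h2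
  rw [mul_comm] at h2
  omega

variable {n : ℕ}

/-- The product of `l` factors that detects the disjunction of the arguments. -/
theorem exists_nor_approximation {V : Type*} [Fintype V] (args : Finset V)
    (y : (Fin n → Bool) → V → Bool) (l : ℕ) :
    ∃ bad : Finset (Fin n → Bool), 2 ^ l * bad.card ≤ 2 ^ n ∧
      ∀ (D : ℕ) (P : V → (Fin n → Bool) → ZMod 3), (∀ a ∈ args, P a ∈ degLE n D) →
        ∃ z ∈ degLE n (2 * l * D), ∀ x, (∀ a ∈ args, P a x = bit3 (y x a)) →
          ((∀ a ∈ args, y x a = false) → z x = 1) ∧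
          ((∃ a ∈ args, y x a = true) → x ∉ bad → z x = 0) := by
  classical
  -- Keeping `bad` among the inputs with a true argument allows it to be halved again. It depends on
  -- the exact values `y` only, hence is fixed before the approximants `P`.
  suffices h : ∃ bad : Finset (Fin n → Bool), 2 ^ l * bad.card ≤ 2 ^ n ∧
      (∀ x ∈ bad, ∃ a ∈ args, y x a = true) ∧
      ∀ (D : ℕ) (P : V → (Fin n → Bool) → ZMod 3), (∀ a ∈ args, P a ∈ degLE n D) →
        ∃ z ∈ degLE n (2 * l * D), ∀ x, (∀ a ∈ args, P a x = bit3 (y x a)) →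
          ((∀ a ∈ args, y x a = false) → z x = 1) ∧
          ((∃ a ∈ args, y x a = true) → x ∉ bad → z x = 0) by
    obtain ⟨bad, h1, -, h2⟩ := h
    exact ⟨bad, h1, h2⟩
  induction l with
  | zero =>
    refine ⟨Finset.univ.filter fun x => ∃ a ∈ args, y x a = true, ?_, by simp, fun D P _ =>
      ⟨1, one_mem_degLE _, fun x _ => ⟨fun _ => rfl, fun h1 h2 => ?_⟩⟩⟩
    · simpa using Finset.card_le_univ (Finset.univ.filter fun x => ∃ a ∈ args, y x a = true)
    · exact absurd (by simpa using h1) h2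
  | succ l ih =>
    obtain ⟨bad, hcard, hbad, hz⟩ := ih
    obtain ⟨c, hc⟩ := exists_linear_form_halving bad args y hbad
    refine ⟨bad.filter fun x => ∑ a ∈ args, c a * bit3 (y x a) = 0, ?_,
      fun x hx => hbad x (Finset.mem_of_mem_filter x hx), fun D P hP => ?_⟩
    · calc 2 ^ (l + 1) * (bad.filter fun x => ∑ a ∈ args, c a * bit3 (y x a) = 0).card
          = 2 ^ l * (2 * (bad.filter fun x => ∑ a ∈ args, c a * bit3 (y x a) = 0).card) := by ring
        _ ≤ 2 ^ l * bad.card := Nat.mul_le_mul_left _ hc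
        _ ≤ 2 ^ n := hcard
    · obtain ⟨z, hzdeg, hz⟩ := hz D P hP
      have hL : (∑ a ∈ args, c a • P a) ∈ degLE n D :=
        Submodule.sum_mem _ fun a ha => Submodule.smul_mem _ _ (hP a ha)
      -- Nonzero elements of the field square to 1, so the new factor is 1 where the form vanishes
      -- and 0 elsewhere.
      refine ⟨z * (1 - (∑ a ∈ args, c a • P a) * ∑ a ∈ args, c a • P a), ?_, fun x hx => ?_⟩
      · rw [show 2 * (l + 1) * D = 2 * l * D + (D + D) by ring]
        exact mul_mem_degLE hzdeg
          (Submodule.sub_mem _ (one_mem_degLE _) (mul_mem_degLE hL hL))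
      · have hval : (∑ a ∈ args, c a • P a) x = ∑ a ∈ args, c a * bit3 (y x a) := by
          rw [Finset.sum_apply]
          exact Finset.sum_congr rfl fun a ha => by simp [hx a ha]
        obtain ⟨h1, h2⟩ := hz x hx
        simp only [Pi.mul_apply, Pi.sub_apply, Pi.one_apply, hval]
        constructor
        · intro h
          rw [h1 h, Finset.sum_eq_zero fun a ha => by simp [bit3, h a ha]]
          simp
        · intro h hxb
          by_cases hxb' : x ∈ bad
          · have hne : ∑ a ∈ args, c a * bit3 (y x a) ≠ 0 := fun h0 =>
              hxb (Finset.mem_filter.2 ⟨hxb', h0⟩)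
            have key : ∀ t : ZMod 3, t ≠ 0 → 1 - t * t = 0 := by decide
            rw [key _ hne, mul_zero]
          · rw [h2 h hxb', zero_mul]

namespace BoolCircuit

theorem nodeDepth_lt_of_mem {m : ℕ} (C : BoolCircuit m) {a v : C.V}
    (h : a ∈ (C.gate v).args) : C.nodeDepth a < C.nodeDepth v := by
  rw [C.nodeDepth_eq v]
  have : ∀ l : List C.V, a ∈ l →
      C.nodeDepth a < (l.map fun a => C.nodeDepth a + 1).foldr max 0 := by
    intro l
    induction l with
    | nil => simp
    | cons b l ih =>
      intro h
      rw [List.map_cons, List.foldr_cons, lt_max_iff]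
      rcases List.mem_cons.1 h with rfl | h
      · exact Or.inl (Nat.lt_succ_self _)
      · exact Or.inr (ih h)
  exact this _ h

/-- A gate agrees with a function of low degree in its arguments outside a small set. -/
theorem exists_gate_approximation {m : ℕ} (C : BoolCircuit m) (hC : C.OracleFree)
    (W : (Fin n → Bool) → Fin m → Bool)
    (hW : ∀ j, (fun x => bit3 (W x j)) ∈ degLE n 1) {l : ℕ} (hl : 1 ≤ l) (v : C.V) :
    ∃ bad : Finset (Fin n → Bool), 2 ^ l * bad.card ≤ 2 ^ n ∧
      ∀ (D : ℕ) (P : C.V → (Fin n → Bool) → ZMod 3), 1 ≤ D →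
        (∀ a ∈ (C.gate v).args, P a ∈ degLE n D) →
        ∃ q ∈ degLE n (2 * l * D), ∀ x ∉ bad,
          (∀ a ∈ (C.gate v).args, P a x = bit3 (C.eval ∅ (W x) a)) →
          q x = bit3 (C.eval ∅ (W x) v) := by
  classical
  have hv := fun x => C.eval_eq ∅ (W x) v
  have hle : ∀ {D}, D ≤ 2 * l * D := fun {D} => Nat.le_mul_of_pos_left D (by omega)
  rcases hg : C.gate v with j | a | s | s | s
  · refine ⟨∅, by simp, fun D P hD _ => ⟨_, degLE_mono (hD.trans hle) (hW j), fun x _ _ => ?_⟩⟩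
    simp [hv, hg, Gate.value]
  · refine ⟨∅, by simp, fun D P _ hP => ⟨1 - P a, ?_, fun x _ hx => ?_⟩⟩
    · exact Submodule.sub_mem _ (one_mem_degLE _) (degLE_mono hle (hP a (by simp [Gate.args])))
    · rw [Pi.sub_apply, hx a (by simp [Gate.args]), hv, hg]
      cases h : C.eval ∅ (W x) a <;> simp [Gate.value, bit3, h]
  -- A conjunction is the NOR of the negated arguments.
  · obtain ⟨bad, hbad, h⟩ := exists_nor_approximation s.toFinset
      (fun x a => !(C.eval ∅ (W x) a)) l
    refine ⟨bad, hbad, fun D P _ hP => ?_⟩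
    obtain ⟨z, hz, hzx⟩ := h D (fun a => 1 - P a) fun a ha =>
      Submodule.sub_mem _ (one_mem_degLE _) (hP a (by simpa [Gate.args] using ha))
    refine ⟨z, hz, fun x hxb hx => ?_⟩
    obtain ⟨h1, h2⟩ := hzx x fun a ha => by
      rw [Pi.sub_apply, hx a (by simpa [Gate.args] using ha)]
      cases h : C.eval ∅ (W x) a <;> simp [bit3]
    rw [hv, hg]
    by_cases hall : ∀ a ∈ s, C.eval ∅ (W x) a = true
    · rw [h1 (by simpa using hall)]
      have : s.all (C.eval ∅ (W x)) = true := List.all_eq_true.2 hall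
      simp [Gate.value, bit3, this]
    · have : s.all (C.eval ∅ (W x)) = false := by
        rw [← Bool.not_eq_true, List.all_eq_true]
        exact hall
      push Not at hall
      rw [h2 (by simpa using hall) hxb]
      simp [Gate.value, bit3, this]
  · obtain ⟨bad, hbad, h⟩ := exists_nor_approximation s.toFinset
      (fun x a => C.eval ∅ (W x) a) l
    refine ⟨bad, hbad, fun D P _ hP => ?_⟩
    obtain ⟨z, hz, hzx⟩ := h D P fun a ha => hP a (by simpa [Gate.args] using ha)
    refine ⟨1 - z, Submodule.sub_mem _ (one_mem_degLE _) hz, fun x hxb hx => ?_⟩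
    obtain ⟨h1, h2⟩ := hzx x fun a ha => hx a (by simpa [Gate.args] using ha)
    rw [hv, hg, Pi.sub_apply]
    by_cases hany : ∃ a ∈ s, C.eval ∅ (W x) a = true
    · rw [h2 (by simpa using hany) hxb]
      have : s.any (C.eval ∅ (W x)) = true := List.any_eq_true.2 hany
      simp [Gate.value, bit3, this]
    · have : s.any (C.eval ∅ (W x)) = false := by
        rw [← Bool.not_eq_true, List.any_eq_true]
        exact hany
      push Not at hany
      rw [h1 (by simpa using hany)]
      simp [Gate.value, bit3, this]
  · exact absurd (by rw [hg]; trivial) (hC v)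

/-- Outside the union of the bad sets of all gates, correctness passes from arguments to gates. The
degree grows by a factor `2 * l` per level. -/
theorem exists_approximation {m : ℕ} (C : BoolCircuit m) (hC : C.OracleFree)
    (W : (Fin n → Bool) → Fin m → Bool)
    (hW : ∀ j, (fun x => bit3 (W x j)) ∈ degLE n 1) {l : ℕ} (hl : 1 ≤ l) (v : C.V) :
    ∃ q ∈ degLE n ((2 * l) ^ (C.depth + 1)), ∃ bad : Finset (Fin n → Bool),
      2 ^ l * bad.card ≤ C.size * 2 ^ n ∧ ∀ x ∉ bad, q x = bit3 (C.eval ∅ (W x) v) := by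
  classical
  choose bad hbad happrox using C.exists_gate_approximation hC W hW hl
  have hnode : ∀ v, ∃ q ∈ degLE n ((2 * l) ^ (C.nodeDepth v + 1)),
      ∀ x, (∀ u, x ∉ bad u) → q x = bit3 (C.eval ∅ (W x) v) := by
    intro v
    induction v using C.wf.induction with
    | _ v ih =>
      have h : ∀ a : C.V, ∃ q : (Fin n → Bool) → ZMod 3, a ∈ (C.gate v).args →
          q ∈ degLE n ((2 * l) ^ C.nodeDepth v) ∧
          ∀ x, (∀ u, x ∉ bad u) → q x = bit3 (C.eval ∅ (W x) a) := by
        intro a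
        by_cases ha : a ∈ (C.gate v).args
        · obtain ⟨q, hq, hqx⟩ := ih a ha
          exact ⟨q, fun _ => ⟨degLE_mono (Nat.pow_le_pow_right (by omega)
            (C.nodeDepth_lt_of_mem ha)) hq, hqx⟩⟩
        · exact ⟨0, fun h => absurd h ha⟩
      choose P hP using h
      obtain ⟨q, hq, hqx⟩ := happrox v ((2 * l) ^ C.nodeDepth v) P
        (Nat.one_le_pow _ _ (by omega)) fun a ha => (hP a ha).1
      refine ⟨q, by rwa [pow_succ'], fun x hx => hqx x (hx v) fun a ha => (hP a ha).2 x hx⟩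
  obtain ⟨q, hq, hqx⟩ := hnode v
  refine ⟨q, degLE_mono (Nat.pow_le_pow_right (by omega) (Nat.succ_le_succ
    (Finset.le_sup (f := C.nodeDepth) (Finset.mem_univ v)))) hq,
    Finset.univ.biUnion bad, ?_, fun x hx => hqx x (by simpa using hx)⟩
  calc 2 ^ l * (Finset.univ.biUnion bad).card
      ≤ 2 ^ l * ∑ u, (bad u).card := Nat.mul_le_mul_left _ Finset.card_biUnion_le
    _ = ∑ u, 2 ^ l * (bad u).card := Finset.mul_sum _ _ _
    _ ≤ ∑ _u : C.V, 2 ^ n := Finset.sum_le_sum fun u _ => hbad u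
    _ = C.size * 2 ^ n := by simp [size]

/-- A circuit without oracle gates that computes parity after a substitution of degree one has
large depth or large size. -/
theorem parity_lower_bound {m k : ℕ} (hk : n = 2 * k) (C : BoolCircuit m) (hC : C.OracleFree)
    (W : (Fin n → Bool) → Fin m → Bool)
    (hW : ∀ j, (fun x => bit3 (W x j)) ∈ degLE n 1) {l d : ℕ} (hl : 8 * C.size ≤ 2 ^ l)
    (hl1 : 1 ≤ l) (hd : C.depth ≤ d)
    (hpar : ∀ x, C.eval ∅ (W x) C.output = ((List.finRange n).map x).foldr xor false) :
    18 * k < 64 * ((2 * l) ^ (d + 1) + 1) ^ 2 := by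
  classical
  obtain ⟨q, hq, bad, hbad, hqx⟩ := C.exists_approximation hC W hW hl1 C.output
  set D := (2 * l) ^ (d + 1) with hD
  -- Adding 1 turns bits into signs, since `1 + 1 = -1` modulo 3.
  have hq' : 1 + q ∈ degLE n D :=
    Submodule.add_mem _ (one_mem_degLE _)
      (degLE_mono (Nat.pow_le_pow_right (by omega) (Nat.succ_le_succ hd)) hq)
  have h1 := card_le_of_agrees_parity badᶜ hk hq' fun x hx => by
    rw [Pi.add_apply, hqx x (by simpa using hx), hpar, signChar_univ]
    cases ((List.finRange n).map x).foldr xor false <;> simp [bit3]; decide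
  subst hk
  have h2 := two_mul_card_filter_card_le k D
  have h3 := two_mul_add_one_mul_centralBinom_sq_le k
  rw [Finset.card_compl] at h1
  simp only [Fintype.card_pi, Fintype.card_bool, Finset.prod_const, Finset.card_univ,
    Fintype.card_fin] at h1
  rw [pow_mul] at h1 hbad
  norm_num at h1 hbad
  have h4 : 8 * bad.card ≤ 4 ^ k := by
    rcases Nat.eq_zero_or_pos C.size with h0 | h0
    · rw [h0, zero_mul] at hbad
      have : bad.card = 0 := by
        by_contra hne
        have : 0 < 2 ^ l * bad.card := by positivity
        omega
      simp [this]
    · refine le_of_mul_le_mul_left (a := C.size) ?_ h0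
      calc C.size * (8 * bad.card) = 8 * C.size * bad.card := by ring
        _ ≤ 2 ^ l * bad.card := Nat.mul_le_mul_right _ hl
        _ ≤ C.size * 4 ^ k := hbad
  -- Agreement on at least 7/8 of the cube exceeds one half by 3/8, which the `D + 1` middle layers
  -- have to cover.
  have h5 : 3 * 4 ^ k ≤ 8 * (D + 1) * k.centralBinom := by
    have : 8 * (D + 1) * k.centralBinom = 4 * (2 * (D + 1) * k.centralBinom) := by ring
    omega
  have h6 : 9 * 16 ^ k ≤ 64 * (D + 1) ^ 2 * k.centralBinom ^ 2 := by
    calc 9 * 16 ^ k = (3 * 4 ^ k) ^ 2 := by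
          rw [mul_pow, ← pow_mul, mul_comm k 2, pow_mul]; norm_num
      _ ≤ (8 * (D + 1) * k.centralBinom) ^ 2 := Nat.pow_le_pow_left h5 2
      _ = 64 * (D + 1) ^ 2 * k.centralBinom ^ 2 := by ring
  have h7 : 9 * (2 * k + 1) * 16 ^ k ≤ 64 * (D + 1) ^ 2 * 16 ^ k := by
    calc 9 * (2 * k + 1) * 16 ^ k = (2 * k + 1) * (9 * 16 ^ k) := by ring
      _ ≤ (2 * k + 1) * (64 * (D + 1) ^ 2 * k.centralBinom ^ 2) := Nat.mul_le_mul_left _ h6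
      _ = 64 * (D + 1) ^ 2 * ((2 * k + 1) * k.centralBinom ^ 2) := by ring
      _ ≤ 64 * (D + 1) ^ 2 * 16 ^ k := Nat.mul_le_mul_left _ h3
  have h8 := Nat.le_of_mul_le_mul_right h7 (pow_pos (by norm_num) k)
  omega

end BoolCircuit

end Approximation

/-! ## Programs over groups represented by contexts -/

/-- A value that depends on at most one input bit. -/
abbrev Projection (n : ℕ) (β : Type*) := Option (Fin n) × (Bool → β)

/-- The value on the input `x`. -/
def Projection.eval {n : ℕ} {β : Type*} (t : Projection n β) (x : Fin n → Bool) : β :=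
  t.2 (t.1.elim false x)

/-- A relation between contexts `(u, v)` over `α` and the elements of `G` they represent. -/
structure ContextRep (α G : Type*) [Group G] where
  rel : List α → List α → G → Prop
  mul : ∀ {u v u' v' g g'}, rel u v g → rel u' v' g' → rel (u ++ u') (v' ++ v) (g * g')
  total : ∀ g, ∃ u v, rel u v g

open scoped commutatorElement

namespace ContextRep

variable {α G : Type*} [Group G] (ρ : ContextRep α G) {n : ℕ}

/-- `φ` is computed by contexts of length at most `ℓ` all of whose letters are projections. -/
def Computes (n ℓ : ℕ) (φ : (Fin n → Bool) → G) : Prop :=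
  ∃ U V : List (Projection n α), U.length ≤ ℓ ∧ V.length ≤ ℓ ∧
    ∀ x, ρ.rel (U.map fun t => t.eval x) (V.map fun t => t.eval x) (φ x)

variable {ρ}

theorem Computes.mono {a b : ℕ} {φ : (Fin n → Bool) → G} (h : ρ.Computes n a φ) (hab : a ≤ b) :
    ρ.Computes n b φ := by
  obtain ⟨U, V, hU, hV, h⟩ := h
  exact ⟨U, V, hU.trans hab, hV.trans hab, h⟩

theorem Computes.mul {a b : ℕ} {φ ψ : (Fin n → Bool) → G} (h : ρ.Computes n a φ)
    (h' : ρ.Computes n b ψ) : ρ.Computes n (a + b) fun x => φ x * ψ x := by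
  obtain ⟨U, V, hU, hV, h⟩ := h
  obtain ⟨U', V', hU', hV', h'⟩ := h'
  refine ⟨U ++ U', V' ++ V, ?_, ?_, fun x => ?_⟩
  · rw [List.length_append]; omega
  · rw [List.length_append]; omega
  · rw [List.map_append, List.map_append]
    exact ρ.mul (h x) (h' x)

theorem exists_select_word (i : Fin n) (u u' : List α) (h : u.length = u'.length) :
    ∃ U : List (Projection n α), U.length = u.length ∧
      ∀ x : Fin n → Bool, U.map (fun t => t.eval x) = if x i then u else u' := by
  induction u generalizing u' with
  | nil =>
    obtain rfl : u' = [] := List.length_eq_zero_iff.1 h.symm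
    exact ⟨[], rfl, fun x => by simp⟩
  | cons a u ih =>
    cases u' with
    | nil => simp at h
    | cons a' u' =>
      obtain ⟨U, hU, hx⟩ := ih u' (by simpa using h)
      refine ⟨(some i, fun b => if b then a else a') :: U, by simp [hU], fun x => ?_⟩
      rw [List.map_cons, hx]
      cases hxi : x i <;> simp [Projection.eval, hxi]

theorem exists_const_word (u : List α) :
    ∃ U : List (Projection n α), U.length = u.length ∧
      ∀ x : Fin n → Bool, U.map (fun t => t.eval x) = u :=
  ⟨u.map fun a => (none, fun _ => a), by simp, fun x => by simp [Projection.eval, Function.comp_def]⟩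

/-- Equal lengths let a single bit choose between the two contexts letter by letter. -/
theorem computes_select (i : Fin n) {u v u' v' : List α} {g g' : G} (h : ρ.rel u v g)
    (h' : ρ.rel u' v' g') (hu : u.length = u'.length) (hv : v.length = v'.length) {ℓ : ℕ}
    (hul : u.length ≤ ℓ) (hvl : v.length ≤ ℓ) :
    ρ.Computes n ℓ fun x => if x i then g else g' := by
  obtain ⟨U, hU, hUx⟩ := exists_select_word i u u' hu
  obtain ⟨V, hV, hVx⟩ := exists_select_word i v v' hv
  refine ⟨U, V, hU ▸ hul, hV ▸ hvl, fun x => ?_⟩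
  rw [hUx, hVx]
  cases hx : x i
  · simpa [hx] using h'
  · simpa [hx] using h

variable (ρ)

/-- Constants, and commutators controlled by an input bit, are computed in bounded length. -/
theorem exists_basic_bound [Finite G] : ∃ κ, ∀ n,
    (∀ g : G, ρ.Computes n κ fun _ => g) ∧
    ∀ (i : Fin n) (g h : G), ρ.Computes n κ fun x => if x i then ⁅g, h⁆ else 1 := by
  have := Fintype.ofFinite G
  choose u v huv using ρ.total
  obtain ⟨κ, hκ⟩ : ∃ κ, ∀ g, (u g).length ≤ κ ∧ (v g).length ≤ κ :=
    ⟨∑ g, ((u g).length + (v g).length), fun g => by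
      have := Finset.single_le_sum (f := fun g => (u g).length + (v g).length)
        (fun _ _ => Nat.zero_le _) (Finset.mem_univ g)
      omega⟩
  refine ⟨4 * κ, fun n => ⟨fun g => ?_, fun i g h => ?_⟩⟩
  · obtain ⟨U, hU, hUx⟩ := exists_const_word (n := n) (u g)
    obtain ⟨V, hV, hVx⟩ := exists_const_word (n := n) (v g)
    refine ⟨U, V, ?_, ?_, fun x => ?_⟩
    · have := (hκ g).1; omega
    · have := (hκ g).2; omega
    · rw [hUx, hVx]
      exact huv g
  -- The same four contexts in two orders: the lengths agree, while the products are `⁅g, h⁆` and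
  -- `1`.
  · have h1 := ρ.mul (ρ.mul (ρ.mul (huv g) (huv h)) (huv g⁻¹)) (huv h⁻¹)
    have h2 := ρ.mul (ρ.mul (ρ.mul (huv g) (huv g⁻¹)) (huv h)) (huv h⁻¹)
    rw [mul_inv_cancel, one_mul, mul_inv_cancel] at h2
    rw [commutatorElement_def]
    have a1 := hκ g
    have a2 := hκ h
    have a3 := hκ g⁻¹
    have a4 := hκ h⁻¹
    refine computes_select i h1 h2 ?_ ?_ ?_ ?_ <;> simp only [List.length_append] <;> omega

/-- Every element of `H`, controlled by the truth value `f`, is computed in length `T`. -/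
def ComputesBool (H : Subgroup G) (n T : ℕ) (f : (Fin n → Bool) → Bool) : Prop :=
  ∀ g ∈ H, ρ.Computes n T fun x => if f x then g else 1

variable {ρ} in
theorem ComputesBool.mono {H : Subgroup G} {a b : ℕ} {f : (Fin n → Bool) → Bool}
    (h : ρ.ComputesBool H n a f) (hab : a ≤ b) : ρ.ComputesBool H n b f :=
  fun g hg => (h g hg).mono hab

/-- Induction over products of commutators in a perfect subgroup. -/
theorem perfect_induction {H : Subgroup G} (hH : ⁅H, H⁆ = H) {p : G → Prop}
    (hc : ∀ g ∈ H, ∀ h ∈ H, p ⁅g, h⁆) (hm : ∀ g h, p g → p h → p (g * h)) :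
    ∀ g ∈ H, p g := by
  intro g hg
  rw [← hH, Subgroup.commutator_def] at hg
  refine Subgroup.closure_induction'' (p := fun g _ => p g) ?_ ?_ ?_ ?_ hg
  · rintro _ ⟨a, ha, b, hb, rfl⟩
    exact hc a ha b hb
  · rintro _ ⟨a, ha, b, hb, rfl⟩
    rw [commutatorElement_inv]
    exact hc b hb a ha
  · simpa using hc 1 H.one_mem 1 H.one_mem
  · exact fun a b _ _ => hm a b

variable {H : Subgroup G}

/-- A bound for each element of a finite group gives a common bound. -/
theorem exists_uniform_bound [Finite G] {p : G → ℕ → Prop} (hp : ∀ g a b, p g a → a ≤ b → p g b)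
    (h : ∀ g ∈ H, ∃ r, p g r) : ∃ r, ∀ g ∈ H, p g r := by
  have := Fintype.ofFinite G
  have h' : ∀ g, ∃ r, g ∈ H → p g r := fun g => by
    by_cases hg : g ∈ H
    · exact (h g hg).imp fun _ hr _ => hr
    · exact ⟨0, fun h => absurd h hg⟩
  choose r hr using h'
  exact ⟨∑ g, r g, fun g hg => hp g _ _ (hr g hg)
    (Finset.single_le_sum (fun _ _ => Nat.zero_le _) (Finset.mem_univ g))⟩

/-- In a commutator with `g` controlled by `f` and `h` by `f'`, everything cancels as soon as one
control is false. Other elements of `H` are products of commutators, and finiteness makes the factor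
uniform. -/
theorem exists_and_bound [Finite G] (hH : ⁅H, H⁆ = H) : ∃ r, ∀ (n T : ℕ) (f f' : (Fin n → Bool) → Bool),
    ρ.ComputesBool H n T f → ρ.ComputesBool H n T f' →
    ρ.ComputesBool H n (r * T) fun x => f x && f' x := by
  have h : ∃ r, ∀ g ∈ H, ∀ (n T : ℕ) (f f' : (Fin n → Bool) → Bool),
      ρ.ComputesBool H n T f → ρ.ComputesBool H n T f' →
      ρ.Computes n (r * T) fun x => if f x && f' x then g else 1 := by
    refine exists_uniform_bound (H := H)
      (p := fun g r => ∀ (n T : ℕ) (f f' : (Fin n → Bool) → Bool),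
        ρ.ComputesBool H n T f → ρ.ComputesBool H n T f' →
        ρ.Computes n (r * T) fun x => if f x && f' x then g else 1)
      (fun g a b h hab n T f f' hf hf' => (h n T f f' hf hf').mono (Nat.mul_le_mul_right _ hab))
      (perfect_induction hH (fun g hg h hh => ⟨4, fun n T f f' hf hf' => ?_⟩) ?_)
    · convert (((hf g hg).mul (hf' h hh)).mul (hf g⁻¹ (H.inv_mem hg))).mul
        (hf' h⁻¹ (H.inv_mem hh)) using 1
      · ring
      · funext x
        cases f x <;> cases f' x <;> simp [commutatorElement_def]
    · rintro g h ⟨r, hr⟩ ⟨s, hs⟩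
      refine ⟨r + s, fun n T f f' hf hf' => ?_⟩
      convert (hr n T f f' hf hf').mul (hs n T f f' hf hf') using 1
      · ring
      · funext x
        cases f x <;> cases f' x <;> simp
  obtain ⟨r, hr⟩ := h
  exact ⟨r, fun n T f f' hf hf' g hg => hr g hg n T f f' hf hf'⟩

theorem exists_var_bound [Finite G] (hH : ⁅H, H⁆ = H) : ∃ r, ∀ (n : ℕ) (i : Fin n),
    ρ.ComputesBool H n r fun x => x i := by
  obtain ⟨κ, hκ⟩ := ρ.exists_basic_bound
  have h : ∃ r, ∀ g ∈ H, ∀ (n : ℕ) (i : Fin n),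
      ρ.Computes n r fun x => if x i then g else 1 := by
    refine exists_uniform_bound (H := H)
      (p := fun g r => ∀ (n : ℕ) (i : Fin n), ρ.Computes n r fun x => if x i then g else 1)
      (fun g a b h hab n i => (h n i).mono hab)
      (perfect_induction hH (fun g _ h _ => ⟨κ, fun n i => (hκ n).2 i g h⟩) ?_)
    rintro g h ⟨r, hr⟩ ⟨s, hs⟩
    refine ⟨r + s, fun n i => ?_⟩
    convert (hr n i).mul (hs n i) using 1
    funext x
    cases x i <;> simp
  obtain ⟨r, hr⟩ := h
  exact ⟨r, fun n i g hg => hr g hg n i⟩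

/-- Boolean operations multiply the program length by a constant (Barrington). -/
theorem exists_boolean_bound [Finite G] (hH : ⁅H, H⁆ = H) : ∃ K, 1 ≤ K ∧ ∀ n,
    (∀ i, ρ.ComputesBool H n K fun x => x i) ∧
    (∀ b, ρ.ComputesBool H n K fun _ => b) ∧
    (∀ T f, K ≤ T → ρ.ComputesBool H n T f → ρ.ComputesBool H n (K * T) fun x => !f x) ∧
    ∀ T f f', ρ.ComputesBool H n T f → ρ.ComputesBool H n T f' →
      ρ.ComputesBool H n (K * T) fun x => f x && f' x := by
  obtain ⟨κ, hκ⟩ := ρ.exists_basic_bound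
  obtain ⟨r, hr⟩ := ρ.exists_and_bound hH
  obtain ⟨s, hs⟩ := ρ.exists_var_bound hH
  refine ⟨κ + r + s + 2, by omega, fun n => ⟨fun i => (hs n i).mono (by omega),
    fun b g _ => ((hκ n).1 _).mono (by omega), fun T f hT hf g hg => ?_,
    fun T f f' hf hf' => (hr n T f f' hf hf').mono (Nat.mul_le_mul_right _ (by omega))⟩⟩
  -- Negation is `g` times `g⁻¹` controlled by `f`. The additive cost of the constant is absorbed
  -- because `K ≤ T` makes `T` positive.
  have h := ((hκ n).1 g).mul (hf g⁻¹ (H.inv_mem hg))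
  have h2 : κ + T ≤ (κ + r + s + 2) * T := by nlinarith
  convert h.mono h2 using 1
  funext x
  cases hx : f x <;> simp [hx]

/-- A program for every node of a circuit of bounded fan-in. -/
theorem computesBool_eval {K : ℕ} (hK1 : 1 ≤ K) {n : ℕ}
    (hvar : ∀ i, ρ.ComputesBool H n K fun x => x i)
    (hconst : ∀ b, ρ.ComputesBool H n K fun _ => b)
    (hnot : ∀ T f, K ≤ T → ρ.ComputesBool H n T f → ρ.ComputesBool H n (K * T) fun x => !f x)
    (hand : ∀ T f f', ρ.ComputesBool H n T f → ρ.ComputesBool H n T f' →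
      ρ.ComputesBool H n (K * T) fun x => f x && f' x)
    (C : BoolCircuit n) (hC : C.OracleFree) {b : ℕ} (hb : C.FanInLE b) (v : C.V) :
    ρ.ComputesBool H n (K * (K ^ (b + 2)) ^ C.nodeDepth v) fun x => C.eval ∅ x v := by
  have hall : ∀ {ι : Type} (l : List ι) (f : ι → (Fin n → Bool) → Bool) (T : ℕ), K ≤ T →
      (∀ a ∈ l, ρ.ComputesBool H n T (f a)) →
      ρ.ComputesBool H n (K ^ l.length * T) fun x => l.all fun a => f a x := by
    intro ι l f T hT hl
    induction l with
    | nil => simpa using (hconst true).mono hT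
    | cons a l ih =>
      have h1 := hand _ _ _ ((hl a (by simp)).mono
        (Nat.le_mul_of_pos_left T (pow_pos hK1 l.length))) (ih fun a ha => hl a (by simp [ha]))
      simpa [pow_succ', mul_assoc] using h1
  induction v using C.wf.induction with
  | _ v ih =>
    -- One level costs at most `b` conjunctions, and for an OR also a negation before and after
    -- them. Gates without arguments are treated apart, so the truncated subtraction is harmless.
    set T := K * (K ^ (b + 2)) ^ (C.nodeDepth v - 1) with hTdef
    have hKT : K ≤ T := Nat.le_mul_of_pos_right K (pow_pos (pow_pos hK1 _) _)
    have hargs : ∀ a ∈ (C.gate v).args, ρ.ComputesBool H n T fun x => C.eval ∅ x a := by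
      intro a ha
      have := C.nodeDepth_lt_of_mem ha
      exact (ih a ha).mono (Nat.mul_le_mul_left _ (Nat.pow_le_pow_right (pow_pos hK1 _) (by omega)))
    have hKle : K ≤ K * (K ^ (b + 2)) ^ C.nodeDepth v :=
      Nat.le_mul_of_pos_right K (pow_pos (pow_pos hK1 _) _)
    have hstep : ∀ a ∈ (C.gate v).args, ∀ j ≤ b + 2,
        K ^ j * T ≤ K * (K ^ (b + 2)) ^ C.nodeDepth v := by
      intro a ha j hj
      have h1 := C.nodeDepth_lt_of_mem ha
      obtain ⟨k, hk⟩ : ∃ k, C.nodeDepth v = k + 1 := ⟨C.nodeDepth v - 1, by omega⟩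
      rw [hTdef, hk, Nat.add_sub_cancel, pow_succ]
      calc K ^ j * (K * (K ^ (b + 2)) ^ k) ≤ K ^ (b + 2) * (K * (K ^ (b + 2)) ^ k) :=
            Nat.mul_le_mul_right _ (Nat.pow_le_pow_right hK1 hj)
        _ = K * ((K ^ (b + 2)) ^ k * K ^ (b + 2)) := by ring
    have hlen := hb v
    have hv : ∀ x, C.eval ∅ x v = _ := fun x => C.eval_eq ∅ x v
    have hv' : (fun x => C.eval ∅ x v) = fun x => (C.gate v).value ∅ x (C.eval ∅ x) :=
      funext hv
    rw [hv']
    rcases hg : C.gate v with j | a | s | s | s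
    · exact (hvar j).mono hKle
    · rw [hg] at hargs hstep
      have ha : a ∈ (BoolCircuit.Gate.not (n := n) a).args := by simp [BoolCircuit.Gate.args]
      exact (hnot T _ hKT (hargs a ha)).mono (by simpa using hstep a ha 1 (by omega))
    · rw [hg] at hargs hstep hlen
      rcases s with _ | ⟨a, s⟩
      · simpa [BoolCircuit.Gate.value] using (hconst true).mono hKle
      · exact (hall (a :: s) (fun a x => C.eval ∅ x a) T hKT hargs).mono
          (hstep a (by simp [BoolCircuit.Gate.args]) _ (hlen.trans (by omega)))
    · rw [hg] at hargs hstep hlen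
      rcases s with _ | ⟨a, s⟩
      · simpa [BoolCircuit.Gate.value] using (hconst false).mono hKle
      · have h1 := hall (a :: s) (fun a x => !C.eval ∅ x a) (K * T)
          (hKT.trans (Nat.le_mul_of_pos_left T hK1)) fun a ha => hnot T _ hKT (hargs a ha)
        have hle : K ≤ K ^ (a :: s).length * (K * T) :=
          hKT.trans ((Nat.le_mul_of_pos_left T hK1).trans
            (Nat.le_mul_of_pos_left _ (pow_pos hK1 _)))
        have h2 := hnot _ _ hle h1
        have h3 : (a :: s).length ≤ b := hlen
        have h4 := h2.mono (b := K * (K ^ (b + 2)) ^ C.nodeDepth v) (by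
          have := hstep a (by simp [BoolCircuit.Gate.args]) ((a :: s).length + 2) (by omega)
          calc K * (K ^ (a :: s).length * (K * T)) = K ^ ((a :: s).length + 2) * T := by ring
            _ ≤ _ := this)
        convert h4 using 1
        funext x
        rw [BoolCircuit.Gate.value, List.not_all_eq_any_not]
        simp
    · exact absurd (by rw [hg]; trivial) (hC v)

/-- A program for the parity of at most `2 ^ k` bits. -/
theorem computesBool_parity {K : ℕ} {n : ℕ} (hK1 : 1 ≤ K)
    (hvar : ∀ i, ρ.ComputesBool H n K fun x => x i)
    (hconst : ∀ b, ρ.ComputesBool H n K fun _ => b)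
    (hnot : ∀ T f, K ≤ T → ρ.ComputesBool H n T f → ρ.ComputesBool H n (K * T) fun x => !f x)
    (hand : ∀ T f f', ρ.ComputesBool H n T f → ρ.ComputesBool H n T f' →
      ρ.ComputesBool H n (K * T) fun x => f x && f' x) (k : ℕ) :
    ∀ l : List (Fin n), l.length ≤ 2 ^ k →
      ρ.ComputesBool H n (K * (K ^ 5) ^ k) fun x => (l.map x).foldr xor false := by
  have hmul : ∀ {T}, K ≤ T → K ≤ K * T := fun {T} h => h.trans (Nat.le_mul_of_pos_left T hK1)
  have hxor : ∀ T f f', K ≤ T → ρ.ComputesBool H n T f → ρ.ComputesBool H n T f' →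
      ρ.ComputesBool H n (K ^ 5 * T) fun x => xor (f x) (f' x) := by
    intro T f f' hT hf hf'
    -- Exclusive or as `¬(¬(f ∧ ¬f') ∧ ¬(¬f ∧ f'))`: five nested operations, one factor `K` for
    -- each.
    have h1 := hand _ _ _ (hf.mono (Nat.le_mul_of_pos_left T hK1)) (hnot T f' hT hf')
    have h2 := hand _ _ _ (hnot T f hT hf) (hf'.mono (Nat.le_mul_of_pos_left T hK1))
    have h3 := hnot _ _ (hmul (hmul (hmul (hmul hT))))
      (hand _ _ _ (hnot _ _ (hmul (hmul hT)) h1) (hnot _ _ (hmul (hmul hT)) h2))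
    convert h3 using 1
    · ring
    · funext x
      cases f x <;> cases f' x <;> rfl
  induction k with
  | zero =>
    intro l hl
    rcases l with _ | ⟨a, _ | ⟨b, l⟩⟩
    · simpa using hconst false
    · simpa using hvar a
    · simp at hl
  | succ k ih =>
    intro l hl
    have h1 := hxor _ _ _ (Nat.le_mul_of_pos_right K (pow_pos (pow_pos hK1 _) _))
      (ih (l.take (2 ^ k)) (by simp)) (ih (l.drop (2 ^ k)) (by rw [List.length_drop]; omega))
    convert h1 using 1
    · ring
    · funext x
      have happ : ∀ s t : List Bool, (s ++ t).foldr xor false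
          = xor (s.foldr xor false) (t.foldr xor false) := by
        intro s t
        induction s with
        | nil => simp
        | cons a s ih => simp [ih]
      rw [← happ, ← List.map_append, List.take_append_drop]

end ContextRep

/-! ## Finiteness of the syntactic Ext-algebra of a visibly pushdown language -/

namespace DVPA

variable {α : Type*} {kind : α → LetterKind} {Q Γ : Type} (A : DVPA kind Q Γ)

theorem run_nil_stack (q : Q) (w : List α) : A.run q w [] = (q, []) := by
  cases w <;> rfl

theorem run_append (q : Q) (u v : List α) (β : List Γ) :
    A.run q (u ++ v) β = A.run (A.run q u β).1 v (A.run q u β).2 := by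
  induction u generalizing q β with
  | nil => rfl
  | cons a u ih =>
    cases β with
    | nil => simp [run_nil_stack]
    | cons s β =>
      rw [List.cons_append]
      simp only [run]
      exact ih _ _

/-- What a call pushes is popped by its matching return, so nothing below the top symbol is ever
read or changed. -/
theorem run_wellMatched {w : List α} (hw : WellMatched kind w) (q : Q) (s : Γ) (β : List Γ) :
    A.run q w (s :: β) = ((A.run q w [s]).1, s :: β) := by
  induction hw generalizing q s β with
  | nil => rfl
  | int c hc => simp [run, A.δ_int q c s hc]
  | wrap a b w ha hb hw ih =>
    obtain ⟨t, -, ht⟩ := A.δ_call q a s ha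
    simp only [run, ht, List.cons_append, List.nil_append, run_append]
    rw [ih _ t (s :: β), ih _ t [s]]
    simp [run, A.δ_ret _ b _ hb]
  | append u v _ _ _ _ ihu ihv =>
    rw [run_append, run_append, ihu q s β, ihu q s [], ihv _ s β]

end DVPA

open scoped commutatorElement

universe u

section Syntactic

variable {α : Type u} {kind : α → LetterKind} {L : Set (List α)}

/-- The setoid that defines the syntactic monoid of a language of well-matched words. -/
abbrev wordSetoid (kind : α → LetterKind) (L : Set (List α)) :
    Setoid (wellMatchedWords kind) :=
  (wellMatchedExtAlgebra kind).syntacticSetoid {w | (w : FreeMonoid α).toList ∈ L}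

/-- The syntactic monoid. -/
abbrev SyntacticMonoid (kind : α → LetterKind) (L : Set (List α)) :=
  ((wellMatchedExtAlgebra kind).con (wordSetoid kind L)
    ((wellMatchedExtAlgebra kind).isCongruence_syntacticSetoid _)).Quotient

/-- The class of a well-matched word in the syntactic monoid. -/
abbrev wordClass (L : Set (List α)) (w : wellMatchedWords kind) : SyntacticMonoid kind L := w

theorem wordClass_eq_iff {w w' : wellMatchedWords kind} :
    wordClass L w = wordClass L w' ↔ ∀ (a b : FreeMonoid α) (h : a * b ∈ wellMatchedWords kind),
      (extMap a b h w : FreeMonoid α).toList ∈ L ↔ (extMap a b h w' : FreeMonoid α).toList ∈ L := by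
  refine (Con.eq _).trans ⟨fun h a b hab => h _ ⟨a, b, hab, rfl⟩, ?_⟩
  rintro h _ ⟨a, b, hab, rfl⟩
  exact h a b hab

theorem finite_syntacticMonoid (hL : IsVPL kind L) : Finite (SyntacticMonoid kind L) := by
  obtain ⟨Q, Γ, _, _, A, rfl⟩ := hL
  let T : wellMatchedWords kind → Q × Γ → Q := fun w p => (A.run p.1 (w : FreeMonoid α).toList [p.2]).1
  have hT : ∀ w w' : wellMatchedWords kind, T w = T w' →
      wordClass A.language w = wordClass A.language w' := by
    intro w w' h
    rw [wordClass_eq_iff]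
    intro a b hab
    have hrun : A.run A.q₀ (extMap a b hab w : FreeMonoid α).toList [A.bot]
        = A.run A.q₀ (extMap a b hab w' : FreeMonoid α).toList [A.bot] := by
      simp only [extMap, FreeMonoid.toList_mul, A.run_append A.q₀]
      generalize A.run A.q₀ a.toList [A.bot] = p
      -- A run that has emptied its stack is stuck; otherwise only the state and the top symbol
      -- matter to the inserted word.
      obtain ⟨q, _ | ⟨s, β⟩⟩ := p
      · simp [A.run_nil_stack]
      · rw [A.run_append q, A.run_append q, A.run_wellMatched w.2, A.run_wellMatched w'.2]
        have := congrFun h (q, s)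
        simp only [T] at this
        rw [this]
    simp only [DVPA.language, Set.mem_ofPred_eq, hrun]
  refine Finite.of_injective (fun r : SyntacticMonoid kind A.language => T (Quotient.out r)) ?_
  intro r r' h
  rw [← Quotient.out_eq r, ← Quotient.out_eq r']
  exact hT _ _ h

/-- A context `(u, v)` induces the map `e` on the syntactic monoid. -/
def InducesMap (kind : α → LetterKind) (L : Set (List α)) (u v : List α)
    (e : SyntacticMonoid kind L → SyntacticMonoid kind L) : Prop :=
  ∃ h : FreeMonoid.ofList u * FreeMonoid.ofList v ∈ wellMatchedWords kind,
    ∀ w, e (wordClass L w) = wordClass L (extMap _ _ h w)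

theorem InducesMap.comp {u v u' v' : List α} {e e' : SyntacticMonoid kind L → SyntacticMonoid kind L}
    (h : InducesMap kind L u v e) (h' : InducesMap kind L u' v' e') :
    InducesMap kind L (u ++ u') (v' ++ v) (e ∘ e') := by
  obtain ⟨hm, h⟩ := h
  obtain ⟨hm', h'⟩ := h'
  refine ⟨?_, fun w => ?_⟩
  · have := (extMap _ _ hm ⟨_, hm'⟩).2
    simpa [extMap, mul_assoc] using this
  · rw [Function.comp, h', h]
    congr 1
    apply Subtype.ext
    simp [extMap, mul_assoc]

theorem exists_inducesMap {e : Function.End (SyntacticMonoid kind L)}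
    (he : e ∈ (syntacticExtAlgebra kind L).O) : ∃ u v, InducesMap kind L u v e := by
  obtain ⟨_, ⟨u, v, h, rfl⟩, he⟩ := he
  exact ⟨u.toList, v.toList, h, he⟩

/-- If the syntactic Ext-algebra is not solvable, some nonsolvable group acts faithfully on the
syntactic monoid by maps that are induced by contexts. -/
theorem exists_nonsolvable_group (h : ¬ (syntacticExtAlgebra kind L).Solvable) :
    ∃ (G : Type u) (_ : Group G) (ι : G → Function.End (SyntacticMonoid kind L)),
      ¬ Group.IsSolvable G ∧ Function.Injective ι ∧ (∀ g h, ι (g * h) = ι g * ι h) ∧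
      ∀ g, ι g ∈ (syntacticExtAlgebra kind L).O := by
  simp only [ExtAlgebra.Solvable, GroupsInSolvable, not_and_or, not_forall] at h
  rcases h with ⟨S, hS, hmul, hns⟩ | ⟨S, hS, hmul, hns⟩
  -- The neutral element of `S` may differ from 1, so it need not act as the identity.
  -- Multiplicativity suffices, together with injectivity, seen by evaluation at 1.
  · refine ⟨S, hS, fun g => fun x => (g : SyntacticMonoid kind L) * x, hns, fun g g' hgg => ?_,
      fun g g' => ?_, fun g => (syntacticExtAlgebra kind L).left_mem _⟩
    · have h1 : (g : SyntacticMonoid kind L) * 1 = g' * 1 := congrFun hgg 1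
      rw [mul_one, mul_one] at h1
      exact Subtype.ext h1
    · funext x
      exact (congrArg (· * x) (hmul g g')).trans (mul_assoc _ _ x)
  · refine ⟨S, hS, fun g => (g : (syntacticExtAlgebra kind L).O).1, hns, fun g g' hgg =>
      Subtype.ext (Subtype.ext hgg), fun g g' => ?_, fun g => (g : (syntacticExtAlgebra kind L).O).2⟩
    exact congrArg Subtype.val (hmul g g')

/-- Distinct group elements act differently on the class of some `m`, and a context `(a, b)`
separates the two images. Since `rel` fixes the induced map, membership depends on the group element
alone; `s` records which of the two leads into `L`. -/
theorem exists_contextRep (hL : IsVPL kind L) (h : ¬ (syntacticExtAlgebra kind L).Solvable) :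
    ∃ (G : Type u) (_ : Group G) (_ : Finite G) (ρ : ContextRep α G), ¬ Group.IsSolvable G ∧
      ∀ g g' : G, g ≠ g' → ∃ (a m b : List α) (s : Bool),
        (∀ u v, ρ.rel u v g → (a ++ u ++ m ++ v ++ b ∈ L ↔ s = true)) ∧
        ∀ u v, ρ.rel u v g' → (a ++ u ++ m ++ v ++ b ∈ L ↔ s = false) := by
  obtain ⟨G, _, ι, hns, hinj, hmul, hmem⟩ := exists_nonsolvable_group h
  have := finite_syntacticMonoid hL
  have : Finite (Function.End (SyntacticMonoid kind L)) :=
    inferInstanceAs (Finite (SyntacticMonoid kind L → SyntacticMonoid kind L))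
  refine ⟨G, _, Finite.of_injective ι hinj,
    { rel := fun u v g => InducesMap kind L u v (ι g)
      mul := fun h h' => by rw [hmul]; exact h.comp h'
      total := fun g => exists_inducesMap (hmem g) }, hns, fun g g' hgg => ?_⟩
  obtain ⟨r, hr⟩ := Function.ne_iff.1 (hinj.ne hgg)
  obtain ⟨m, rfl⟩ : ∃ m, wordClass L m = r := Quotient.exists_rep r
  obtain ⟨w, hw⟩ : ∃ w, wordClass L w = ι g (wordClass L m) := Quotient.exists_rep _
  obtain ⟨w', hw'⟩ : ∃ w, wordClass L w = ι g' (wordClass L m) := Quotient.exists_rep _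
  rw [← hw, ← hw', Ne, wordClass_eq_iff] at hr
  push Not at hr
  obtain ⟨a, b, hab, hne⟩ := hr
  have key : ∀ {g₀ w₀}, wordClass L w₀ = ι g₀ (wordClass L m) → ∀ {u v},
      InducesMap kind L u v (ι g₀) →
      (a.toList ++ u ++ (m : FreeMonoid α).toList ++ v ++ b.toList ∈ L ↔
        (extMap a b hab w₀ : FreeMonoid α).toList ∈ L) := by
    rintro g₀ w₀ hw₀ u v ⟨huv, hind⟩
    rw [hind, wordClass_eq_iff] at hw₀
    rw [hw₀ a b hab]
    simp [extMap]
  classical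
  refine ⟨a.toList, (m : FreeMonoid α).toList, b.toList,
    decide ((extMap a b hab w : FreeMonoid α).toList ∈ L),
    fun u v huv => (key hw huv).trans (by simp), fun u v huv => (key hw' huv).trans ?_⟩
  rw [decide_eq_false_iff_not]
  tauto

/-! ### Programs as projections of the encoded language. -/

theorem BlockEncoding.flatMap_injective (c : BlockEncoding α) :
    Function.Injective fun w : List α => w.flatMap c.code := by
  intro w
  induction w with
  | nil =>
    rintro (_ | ⟨a, w⟩) h
    · rfl
    · have h1 := congrArg List.length h
      have h2 := c.width_pos
      simp [c.length_code] at h1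
      omega
  | cons a w ih =>
    rintro (_ | ⟨a', w'⟩) h
    · have h1 := congrArg List.length h
      have h2 := c.width_pos
      simp [c.length_code] at h1
      omega
    · simp only [List.flatMap_cons] at h
      obtain ⟨h1, h2⟩ := List.append_inj h (by rw [c.length_code, c.length_code])
      rw [c.injective h1, ih h2]

theorem BlockEncoding.exists_bits (c : BlockEncoding α) {n : ℕ} (U : List (Projection n α)) :
    ∃ W : List (Projection n Bool), W.length = U.length * c.width ∧
      ∀ x, W.map (fun t => t.eval x) = (U.map fun t => t.eval x).flatMap c.code := by
  induction U with
  | nil => exact ⟨[], by simp, fun x => rfl⟩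
  | cons t U ih =>
    obtain ⟨W, hW, hWx⟩ := ih
    -- Each bit of a block depends on the same input bit as its letter; the default of `getD` is
    -- never reached, as `j < c.width`.
    refine ⟨(List.range c.width).map (fun j => (t.1, fun b => (c.code (t.2 b)).getD j false)) ++ W,
      by simp [hW]; ring, fun x => ?_⟩
    rw [List.map_append, hWx, List.map_cons, List.flatMap_cons]
    congr 1
    refine List.ext_getElem (by simp [c.length_code]) fun j h1 h2 => ?_
    have h3 : (c.code (t.eval x))[j]? = some (c.code (t.eval x))[j] := List.getElem?_eq_getElem h2
    simp only [List.getElem_map, List.getElem_range, Projection.eval, List.getD_eq_getElem?_getD]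
    exact congrArg (Option.getD · false) h3

/-- A function with short programs for it and its negation is a short projection of the
language. -/
theorem exists_projection_of_computesBool (c : BlockEncoding α) (hL : IsVPL kind L)
    (h : ¬ (syntacticExtAlgebra kind L).Solvable) :
    ∃ (G : Type u) (_ : Group G) (_ : Finite G) (ρ : ContextRep α G) (H : Subgroup G),
      ⁅H, H⁆ = H ∧ ∃ M, ∀ (n T : ℕ) (f : (Fin n → Bool) → Bool), 1 ≤ T →
        ρ.ComputesBool H n T f → (ρ.ComputesBool H n T fun x => !f x) →
        ∃ W : List (Projection n Bool), W.length ≤ M * T ∧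
          ∀ x, W.map (fun t => t.eval x) ∈ c.lang L ↔ f x = true := by
  obtain ⟨G, _, _, ρ, hns, hsep⟩ := exists_contextRep hL h
  -- A finite group that is not solvable has a nontrivial subgroup whose commutator subgroup is not
  -- smaller.
  rw [Group.isSolvable_iff_commutator_lt] at hns
  push Not at hns
  obtain ⟨H, hbot, hlt⟩ := hns
  have hH : ⁅H, H⁆ = H := by
    by_contra hne
    refine hlt (lt_of_le_of_ne (Subgroup.commutator_le.2 fun a ha b hb => ?_) hne)
    exact H.mul_mem (H.mul_mem (H.mul_mem ha hb) (H.inv_mem ha)) (H.inv_mem hb)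
  obtain ⟨g, hgH, hg⟩ := H.bot_or_exists_ne_one.resolve_left hbot
  obtain ⟨a, m, b, s, hs, hs'⟩ := hsep g 1 hg
  refine ⟨G, _, ‹_›, ρ, H, hH, (a.length + m.length + b.length + 2) * c.width,
    fun n T f hT hf hf' => ?_⟩
  -- Membership may signal `g` or `1`; in the latter case the program for the negation is used.
  have hcomp : ρ.Computes n T fun x => if f x = s then g else 1 := by
    cases s
    · simpa using hf' g hgH
    · exact hf g hgH
  obtain ⟨U, V, hU, hV, hUV⟩ := hcomp
  obtain ⟨A, hA, hAx⟩ := ContextRep.exists_const_word (n := n) a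
  obtain ⟨B, hB, hBx⟩ := ContextRep.exists_const_word (n := n) b
  obtain ⟨N, hN, hNx⟩ := ContextRep.exists_const_word (n := n) m
  obtain ⟨W, hW, hWx⟩ := c.exists_bits (A ++ U ++ N ++ V ++ B)
  refine ⟨W, ?_, fun x => ?_⟩
  · rw [hW, mul_right_comm]
    refine Nat.mul_le_mul_right _ ?_
    simp only [List.length_append, hA, hB, hN]
    nlinarith [Nat.zero_le (a.length + m.length + b.length)]
  · rw [hWx, BlockEncoding.lang, c.flatMap_injective.mem_set_image]
    simp only [List.map_append, hAx, hBx, hNx]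
    have hx : ρ.rel _ _ (if f x = s then g else 1) := hUV x
    by_cases hfs : f x = s
    · rw [if_pos hfs] at hx
      rw [hs _ _ hx, hfs]
    · rw [if_neg hfs] at hx
      rw [hs' _ _ hx]
      cases s <;> simpa using hfs

/-- Circuits of bounded fan-in, and parities, are short projections of the language. -/
theorem exists_projections (c : BlockEncoding α) (hL : IsVPL kind L)
    (h : ¬ (syntacticExtAlgebra kind L).Solvable) :
    ∃ K M : ℕ, 1 ≤ K ∧
      (∀ (n : ℕ) (C : BoolCircuit n) (b : ℕ), C.OracleFree → C.FanInLE b →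
        ∃ W : List (Projection n Bool),
          W.length ≤ M * (K ^ (b + 2)) ^ C.nodeDepth C.output ∧
          ∀ x, W.map (fun t => t.eval x) ∈ c.lang L ↔ C.eval ∅ x C.output = true) ∧
      ∀ n k, n ≤ 2 ^ k → ∃ W : List (Projection n Bool), W.length ≤ M * (K ^ 5) ^ k ∧
          ∀ x, W.map (fun t => t.eval x) ∈ c.lang L ↔
            ((List.finRange n).map x).foldr xor false = true := by
  obtain ⟨G, _, _, ρ, H, hH, M, hM⟩ := exists_projection_of_computesBool c hL h
  obtain ⟨K, hK, hB⟩ := ρ.exists_boolean_bound hH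
  have hpos : ∀ e k, 1 ≤ K * (K * (K ^ e) ^ k) := fun e k =>
    Nat.mul_pos hK (Nat.mul_pos hK (pow_pos (pow_pos hK _) _))
  have hle : ∀ e k, K ≤ K * (K ^ e) ^ k := fun e k =>
    Nat.le_mul_of_pos_right K (pow_pos (pow_pos hK _) _)
  -- One factor `K` is the base length of a program, the other pays for the program of the negation.
  refine ⟨K, M * K * K, hK, fun n C b hC hb => ?_, fun n k hn => ?_⟩
  · obtain ⟨h1, h2, h3, h4⟩ := hB n
    have hev := ContextRep.computesBool_eval ρ hK h1 h2 h3 h4 C hC hb C.output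
    obtain ⟨W, hW, hWx⟩ := hM n _ _ (hpos _ _) (hev.mono (Nat.le_mul_of_pos_left _ hK))
      (h3 _ _ (hle _ _) hev)
    exact ⟨W, hW.trans (le_of_eq (by ring)), hWx⟩
  · obtain ⟨h1, h2, h3, h4⟩ := hB n
    have hev := ContextRep.computesBool_parity ρ hK h1 h2 h3 h4 k (List.finRange n) (by simpa using hn)
    obtain ⟨W, hW, hWx⟩ := hM n _ _ (hpos _ _) (hev.mono (Nat.le_mul_of_pos_left _ hK))
      (h3 _ _ (hle _ _) hev)
    exact ⟨W, hW.trans (le_of_eq (by ring)), hWx⟩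

end Syntactic

/-! ## Hardness -/

namespace BoolCircuit

theorem nodeDepth_le_rank {m : ℕ} (C : BoolCircuit m) (rk : C.V → ℕ)
    (h : ∀ v, ∀ a ∈ (C.gate v).args, rk a < rk v) (v : C.V) : C.nodeDepth v ≤ rk v := by
  induction v using C.wf.induction with
  | _ v ih =>
    rw [C.nodeDepth_eq v]
    have : ∀ l : List C.V, (∀ a ∈ l, C.nodeDepth a < rk v) →
        (l.map fun a => C.nodeDepth a + 1).foldr max 0 ≤ rk v := by
      intro l hl
      induction l with
      | nil => simp
      | cons a l ihl =>
        rw [List.map_cons, List.foldr_cons]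
        exact max_le (hl a (by simp)) (ihl fun b hb => hl b (by simp [hb]))
    exact this _ fun a ha => (ih a ha).trans_lt (h v a ha)

variable {n : ℕ}

/-- The gates of a circuit with a single oracle gate, whose arguments are constants and
literals. -/
def projectionGate (l : List ((Fin n × Bool) ⊕ Bool)) :
    Option ((Fin n × Bool) ⊕ Bool) → Gate n (Option ((Fin n × Bool) ⊕ Bool))
  | none => Gate.oracle (l.map some)
  | some (Sum.inl (i, true)) => Gate.input i
  | some (Sum.inl (i, false)) => Gate.not (some (Sum.inl (i, true)))
  | some (Sum.inr true) => Gate.and []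
  | some (Sum.inr false) => Gate.or []

/-- A bound for the depth of a node. -/
def projectionRank : Option ((Fin n × Bool) ⊕ Bool) → ℕ
  | none => 2
  | some (Sum.inl (_, true)) => 0
  | some (Sum.inl (_, false)) => 1
  | some (Sum.inr _) => 0

theorem projectionRank_lt (l : List ((Fin n × Bool) ⊕ Bool))
    (v a : Option ((Fin n × Bool) ⊕ Bool)) (h : a ∈ (projectionGate l v).args) :
    projectionRank a < projectionRank v := by
  rcases v with _ | ⟨⟨i, _ | _⟩⟩ | _ | _
  · obtain ⟨⟨i, _ | _⟩ | _, _, rfl⟩ := List.mem_map.1 h <;> simp [projectionRank]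
  · obtain rfl := List.mem_singleton.1 h
    simp [projectionRank]
  all_goals cases h

/-- A circuit with a single oracle gate, whose arguments are constants and literals. -/
def projectionCircuit (l : List ((Fin n × Bool) ⊕ Bool)) : BoolCircuit n where
  V := Option ((Fin n × Bool) ⊕ Bool)
  gate := projectionGate l
  output := none
  wf := Subrelation.wf (fun {a v} h => projectionRank_lt l v a h) (measure projectionRank).wf

/-- The node that computes a projection. -/
def projectionNode (t : Projection n Bool) : (Fin n × Bool) ⊕ Bool :=
  match t.1 with
  | none => Sum.inr (t.2 false)
  | some i => if t.2 false = t.2 true then Sum.inr (t.2 true) else Sum.inl (i, t.2 true)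

theorem eval_projectionNode (l : List ((Fin n × Bool) ⊕ Bool)) (O : Set (List Bool))
    (x : Fin n → Bool) (t : Projection n Bool) :
    (projectionCircuit l).eval O x (some (projectionNode t)) = t.eval x := by
  have hconst : ∀ b, (projectionCircuit l).eval O x (some (Sum.inr b)) = b := fun b =>
    (eval_eq _ O x _).trans (by cases b <;> rfl)
  have hinput : ∀ i, (projectionCircuit l).eval O x (some (Sum.inl (i, true))) = x i := fun i =>
    eval_eq _ O x _
  have hnot : ∀ i, (projectionCircuit l).eval O x (some (Sum.inl (i, false))) = !x i := fun i =>
    (eval_eq _ O x _).trans (congrArg not (hinput i))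
  obtain ⟨_ | i, f⟩ := t
  · exact hconst _
  · simp only [projectionNode, Projection.eval, Option.elim_some]
    split_ifs with h
    · rw [hconst]
      cases x i <;> simp [h]
    · cases hf : f true
      · rw [hnot]
        cases hx : x i <;> simp_all
      · rw [hinput]
        cases hx : x i <;> simp_all

theorem eval_projectionCircuit (W : List (Projection n Bool)) (O : Set (List Bool))
    (x : Fin n → Bool) :
    (projectionCircuit (W.map projectionNode)).eval O x none = true ↔
      W.map (fun t => t.eval x) ∈ O := by
  classical
  refine (Bool.eq_iff_iff.1 (eval_eq (projectionCircuit (W.map projectionNode)) O x none)).trans ?_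
  have h : ((W.map projectionNode).map some).map
      ((projectionCircuit (W.map projectionNode)).eval O x) = W.map fun t => t.eval x := by
    refine (List.map_map ..).trans ((List.map_map ..).trans ?_)
    exact List.map_congr_left fun t _ => eval_projectionNode _ O x t
  rw [← h]
  exact decide_eq_true_iff

end BoolCircuit

open BoolCircuit

/-- Projections of polynomial length are constant-depth reductions. -/
theorem cdReducible_of_projections {K L : Set (List Bool)} (p : Polynomial ℕ)
    (W : ∀ n, List (Projection n Bool)) (hW : ∀ n, (W n).length ≤ p.eval n)
    (h : ∀ n (x : Fin n → Bool), (W n).map (fun t => t.eval x) ∈ L ↔ List.ofFn x ∈ K) :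
    CDReducible K L := by
  -- There are `2n` literals, two constants and one oracle gate, whose fan-in `p` bounds. The
  -- longest path is input, negation, oracle.
  refine ⟨fun n => projectionCircuit ((W n).map projectionNode),
    p + (2 * Polynomial.X + 3), 2, fun n => ⟨?_, ?_, ?_, ?_, ?_⟩, fun n x => ?_⟩
  · rintro (_ | ⟨⟨i, _ | _⟩⟩ | _ | _) a ha
    · cases ha
    · obtain rfl : some (Sum.inl (i, true)) = a := by
        injection ha
      exact ⟨i, rfl⟩
    · cases ha
    · cases ha
    · cases ha
  · intro v w hv hw hvw
    have hone : ∀ u, ((projectionCircuit ((W n).map projectionNode)).gate u).IsOracle → u = none := by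
      rintro (_ | ⟨⟨i, _ | _⟩⟩ | _ | _) hu
      · rfl
      all_goals exact absurd hu id
    have hlt : ∀ u u', Relation.TransGen
        (projectionCircuit ((W n).map projectionNode)).Wire u u' →
        projectionRank u < projectionRank u' := by
      intro u u' huu
      induction huu with
      | single h => exact projectionRank_lt _ _ _ h
      | tail _ h ih => exact ih.trans (projectionRank_lt _ _ _ h)
    have := hlt v w hvw
    rw [hone v hv, hone w hw] at this
    exact lt_irrefl _ this
  · rintro (_ | ⟨⟨i, _ | _⟩⟩ | _ | _) hv
    · change (((W n).map projectionNode).map some).length ≤ _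
      rw [List.length_map, List.length_map, Polynomial.eval_add]
      exact (hW n).trans (Nat.le_add_right _ _)
    all_goals exact absurd hv id
  · have : (projectionCircuit ((W n).map projectionNode)).size = n * 2 + 2 + 1 := by
      change Fintype.card (Option ((Fin n × Bool) ⊕ Bool)) = _
      simp
    rw [this]
    simp
    omega
  · refine Finset.sup_le fun v _ => (nodeDepth_le_rank _ projectionRank
      (fun v a h => projectionRank_lt _ v a h) v).trans ?_
    rcases v with _ | ⟨⟨i, _ | _⟩⟩ | _ <;> simp [projectionRank]
  · exact (eval_projectionCircuit (W n) L x).trans (h n x)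

/-- The program length is `q` to a logarithmic depth, and `q ≤ 2 ^ q` turns this into a power of `2n
+ 2`. -/
theorem nc1Hard_lang {α : Type*} {kind : α → LetterKind} (c : BlockEncoding α) {L : Set (List α)}
    (hL : IsVPL kind L) (hns : ¬ (syntacticExtAlgebra kind L).Solvable) :
    NC1Hard (c.lang L) := by
  rintro K ⟨C, p, e, b, hC, hK⟩
  obtain ⟨B, M, hB, hproj, -⟩ := exists_projections c hL hns
  choose W hW hWx using fun n => hproj n (C n) b (hC n).1 (hC n).2.1
  refine cdReducible_of_projections
    (Polynomial.C M * (2 * Polynomial.X + 2) ^ (B ^ (b + 2) * e)) W (fun n => ?_)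
    fun n x => (hWx n x).trans (hK n x)
  refine (hW n).trans ?_
  simp only [Polynomial.eval_mul, Polynomial.eval_C, Polynomial.eval_pow, Polynomial.eval_add,
    Polynomial.eval_X, Polynomial.eval_ofNat]
  refine Nat.mul_le_mul_left _ ?_
  have hdepth : (C n).nodeDepth (C n).output ≤ e * (Nat.log 2 n + 1) :=
    (Finset.le_sup (f := (C n).nodeDepth) (Finset.mem_univ _)).trans (hC n).2.2.2
  have hlog : 2 ^ (Nat.log 2 n + 1) ≤ 2 * n + 2 := by
    rcases Nat.eq_zero_or_pos n with rfl | hn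
    · simp
    · have := Nat.pow_log_le_self 2 hn.ne'
      rw [pow_succ]
      omega
  set q := B ^ (b + 2)
  calc q ^ (C n).nodeDepth (C n).output ≤ q ^ (e * (Nat.log 2 n + 1)) :=
        Nat.pow_le_pow_right (pow_pos hB _) hdepth
    _ ≤ (2 ^ q) ^ (e * (Nat.log 2 n + 1)) := Nat.pow_le_pow_left Nat.lt_two_pow_self.le _
    _ = (2 ^ (Nat.log 2 n + 1)) ^ (q * e) := by rw [← pow_mul, ← pow_mul]; congr 1; ring
    _ ≤ (2 * n + 2) ^ (q * e) := Nat.pow_le_pow_left hlog _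

/-! ### Parity as a projection contradicts constant depth. -/

theorem exists_mul_pow_lt_two_pow (F g : ℕ) : ∃ k : ℕ, F * (k + 1) ^ g < 2 ^ k := by
  have h := (tendsto_pow_const_div_const_pow_of_one_lt g (one_lt_two (α := ℝ))).eventually
    (gt_mem_nhds (show (0 : ℝ) < 1 / (2 * F + 2) by positivity))
  obtain ⟨N, hN⟩ := Filter.eventually_atTop.1 h
  have h1 := hN (N + 1) (Nat.le_succ N)
  refine ⟨N, ?_⟩
  rw [div_lt_div_iff₀ (by positivity) (by positivity), one_mul] at h1
  have h2 : (N + 1) ^ g * (2 * F + 2) < 2 ^ (N + 1) := by exact_mod_cast h1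
  rw [pow_succ] at h2
  have h3 : (N + 1) ^ g * (2 * F + 2) = 2 * (F * (N + 1) ^ g) + 2 * (N + 1) ^ g := by ring
  omega

theorem Polynomial.exists_eval_le (p : Polynomial ℕ) : ∃ a b : ℕ, ∀ x, p.eval x ≤ a * (x + 1) ^ b := by
  refine ⟨∑ i ∈ Finset.range (p.natDegree + 1), p.coeff i, p.natDegree, fun x => ?_⟩
  rw [Polynomial.eval_eq_sum_range, Finset.sum_mul]
  refine Finset.sum_le_sum fun i hi => Nat.mul_le_mul_left _ ?_
  exact (Nat.pow_le_pow_left (Nat.le_succ x) i).trans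
    (Nat.pow_le_pow_right (Nat.succ_pos x) (by simpa [Nat.lt_succ_iff] using hi))

theorem not_inAC0_lang {α : Type*} {kind : α → LetterKind} (c : BlockEncoding α)
    {L : Set (List α)} (hL : IsVPL kind L) (hns : ¬ (syntacticExtAlgebra kind L).Solvable) :
    ¬ InAC0 (c.lang L) := by
  rintro ⟨C, p, d, hC, hdec⟩
  obtain ⟨K, M, hK, -, hproj⟩ := exists_projections c hL hns
  obtain ⟨a, b, hp⟩ := p.exists_eval_le
  set q := K ^ 5 with hq
  -- The summands pay for the factor 8, for `a ≤ 2 ^ a`, and for the `b`-th power of the projection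
  -- length plus one; thus `l = E * (k + 1)` is logarithmic in the number of bits.
  set E := 3 + a + (M + 1 + q) * b with hE
  -- The constant 256 is `64 * 2 ^ 2`, the 2 absorbing the `+ 1` inside the square of the parity
  -- bound.
  obtain ⟨k, hk⟩ := exists_mul_pow_lt_two_pow (256 * ((2 * E) ^ (d + 1)) ^ 2) (2 * (d + 1))
  obtain ⟨W, hW, hWx⟩ := hproj (2 * 2 ^ k) (k + 1) (by rw [pow_succ, mul_comm])
  have hlist : ∀ x : Fin (2 * 2 ^ k) → Bool,
      List.ofFn (fun j : Fin W.length => (W[j]).eval x) = W.map fun t => t.eval x := by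
    intro x
    refine List.ext_getElem (by simp) fun j h1 h2 => ?_
    simp
  have hsize : 8 * (C W.length).size ≤ 2 ^ (E * (k + 1)) := by
    have hlen : W.length + 1 ≤ 2 ^ ((M + 1 + q) * (k + 1)) := by
      have h1 : 1 ≤ q ^ (k + 1) := Nat.one_le_pow _ _ (pow_pos hK _)
      calc W.length + 1 ≤ (M + 1) * q ^ (k + 1) := by nlinarith
        _ ≤ 2 ^ (M + 1) * (2 ^ q) ^ (k + 1) :=
          Nat.mul_le_mul Nat.lt_two_pow_self.le (Nat.pow_le_pow_left Nat.lt_two_pow_self.le _)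
        _ = 2 ^ (M + 1 + q * (k + 1)) := by rw [← pow_mul, ← pow_add]
        _ ≤ 2 ^ ((M + 1 + q) * (k + 1)) := Nat.pow_le_pow_right two_pos (by nlinarith)
    calc 8 * (C W.length).size ≤ 8 * (a * (W.length + 1) ^ b) :=
          Nat.mul_le_mul_left _ (((hC _).2.1).trans (hp _))
      _ ≤ 2 ^ 3 * (2 ^ a * (2 ^ ((M + 1 + q) * (k + 1))) ^ b) := by
          refine Nat.mul_le_mul (by norm_num) (Nat.mul_le_mul Nat.lt_two_pow_self.le
            (Nat.pow_le_pow_left hlen b))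
      _ = 2 ^ (3 + a + (M + 1 + q) * (k + 1) * b) := by
          rw [← pow_mul, ← pow_add, ← pow_add, ← add_assoc]
      _ ≤ 2 ^ (E * (k + 1)) := Nat.pow_le_pow_right two_pos (by rw [hE]; nlinarith)
  have hbound := (C W.length).parity_lower_bound rfl (hC _).1
    (fun x j => (W[j]).eval x) (fun j => ?_) hsize
    (Nat.mul_pos (by omega) (Nat.succ_pos k)) (hC _).2.2 fun x => ?_
  · have h1 : 1 ≤ (2 * (E * (k + 1))) ^ (d + 1) :=
      Nat.one_le_pow _ _ (Nat.mul_pos two_pos (Nat.mul_pos (by omega) (Nat.succ_pos k)))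
    have h2 : 64 * ((2 * (E * (k + 1))) ^ (d + 1) + 1) ^ 2
        ≤ 256 * ((2 * E) ^ (d + 1)) ^ 2 * (k + 1) ^ (2 * (d + 1)) := by
      calc 64 * ((2 * (E * (k + 1))) ^ (d + 1) + 1) ^ 2
          ≤ 64 * (2 * (2 * (E * (k + 1))) ^ (d + 1)) ^ 2 :=
            Nat.mul_le_mul_left _ (Nat.pow_le_pow_left (by omega) 2)
        _ = 256 * ((2 * E) ^ (d + 1)) ^ 2 * (k + 1) ^ (2 * (d + 1)) := by
            rw [← mul_assoc 2 E, mul_pow (2 * E) (k + 1), mul_comm 2 (d + 1), pow_mul (k + 1)]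
            ring
    omega
  · change (fun x => bit3 ((W[j]).eval x)) ∈ _
    obtain ⟨_ | i, f⟩ := W[j]
    · exact const_mem_degLE 1 (bit3 (f false))
    · exact coordinate_mem_degLE i fun b => bit3 (f b)
  · rw [Bool.eq_iff_iff, hdec, hlist, hWx]

theorem mainTheorem8 {α : Type*} [Finite α] (kind : α → LetterKind) (c : BlockEncoding α)
    (L : Set (List α)) (hL : IsVPL kind L)
    (hns : ¬ (syntacticExtAlgebra kind L).Solvable) :
    NC1Hard (c.lang L) ∧ ¬ InAC0 (c.lang L) :=
  ⟨nc1Hard_lang c hL hns, not_inAC0_lang c hL hns⟩
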